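/- Let $M\ge 1$, $\lambda,\mu>0$, $\gamma_1,\dots,\gamma_M>0$ with $\sum_{j=1}^M\gamma_j=1$, $0<C_1\le C_2\le\dots\le C_M$, and let $d_1,\dots,d_M\ge 1$ be integers. Let $\bar{\mathcal U}$ be the set of real sequences $(g_n)_{n\ge 0}$ with $g_0=1$ and $g_n\ge g_{n+1}\ge 0$ for all $n$, and let $\mathcal U$ be the set of those $g\in\bar{\mathcal U}$ with $\sum_{n}g_n<\infty$. Equip $\bar{\mathcal U}^M$ with the metric $\|u-w\|=\sup_{1\le j\le M}\sup_{n\ge 0}\frac{|u^{(j)}_n-w^{(j)}_n|}{n+1}$. For $u\in\bar{\mathcal U}^M$ put $l^{(j)}_0(u)=\tilde l^{(j)}_0(u)=0$ and, for $k\ge 1$ and $1\le j\le M$, $$l^{(j)}_k(u)=\frac{\lambda}{\gamma_j}\Big(\big(u^{(j)}_{k-1}\big)^{d_j}-\big(u^{(j)}_{k}\big)^{d_j}\Big)\prod_{i=1}^{j-1}\big(u^{(i)}_{k-1}\big)^{d_i}\prod_{i=j+1}^{M}\big(u^{(i)}_{k}\big)^{d_i}-\mu C_j\big(u^{(j)}_k-u^{(j)}_{k+1}\big),$$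 $$\tilde l^{(j)}_k(u)=\frac{\lambda}{\gamma_j}\Big(\big(u^{(j)}_{k-1}\big)^{d_j}-\big(u^{(j)}_{k}\big)^{d_j}\Big)\prod_{i=1}^{j-1}\Big(u^{(i)}_{\lceil (k-1)C_i/C_j\rceil}\Big)^{d_i}\prod_{i=j+1}^{M}\Big(u^{(i)}_{\lfloor (k-1)C_i/C_j\rfloor+1}\Big)^{d_i}-\mu C_j\big(u^{(j)}_k-u^{(j)}_{k+1}\big).$$ The mean field of Scheme 1 (respectively Scheme 2) with initial point $g$ is the solution $u(t,g)\in\bar{\mathcal U}^M$, $t\ge 0$, of $\dot u=l(u)$ (respectively $\dot u=\tilde l(u)$), $u(0)=g$, the equation being understood in each coordinate. An equilibrium is a point at which the vector field vanishes. Assume $\lambda<\mu\sum_{j=1}^M\gamma_jC_j$. Then there are an equilibrium $P\in\mathcal U^M$ of the system of Scheme 1 and an equilibrium $\tilde P\in\mathcal U^M$ of the system of Scheme 2 such that the following hold. 1. For every $g\in\mathcal U^M$ each of the two systems has a unique solution $u(t,g)$, $t\ge 0$, in $\bar{\mathcal U}^M$, and $\lim_{t\to\infty}u(t,g)=P$ for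 Scheme 1 and $\lim_{t\to\infty}u(t,g)=\tilde P$ for Scheme 2. 2. $P$ and $\tilde P$ are globally asymptotically stable in $\mathcal U^M$ for the respective systems: besides the convergence in 1, for every $\varepsilon>0$ there is $\delta>0$ such that every $g\in\mathcal U^M$ with $\|g-P\|<\delta$ satisfies $\|u(t,g)-P\|<\varepsilon$ for all $t\ge 0$ (for Scheme 2 the same with $\tilde P$ in place of $P$). 3. $P$ and $\tilde P$ are the only equilibria in $\mathcal U^M$ of the respective systems. -/

import Mathlib

open Filter Topology

noncomputable section

/-- The space `Ū^M`: families indexed by the type `j` and the level `n`, each of whose sequences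
starts at `1`, is nonincreasing and is nonnegative. -/
def tailSpaceBar (M : ℕ) : Set (Fin M → ℕ → ℝ) :=
  {g | ∀ j, g j 0 = 1 ∧ ∀ n, g j (n + 1) ≤ g j n ∧ 0 ≤ g j (n + 1)}

/-- The space `U^M`: the elements of `Ū^M` all of whose sequences are summable. -/
def tailSpace (M : ℕ) : Set (Fin M → ℕ → ℝ) :=
  {g | g ∈ tailSpaceBar M ∧ ∀ j, Summable (g j)}

/-- The metric `sup_j sup_n |u_n^(j) - w_n^(j)| / (n + 1)`. It is used only between points of
`Ū^M`, where all the terms lie in `[0, 1]`. -/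
def tailDist {M : ℕ} (u w : Fin M → ℕ → ℝ) : ℝ :=
  ⨆ j : Fin M, ⨆ n : ℕ, |u j n - w j n| / ((n : ℝ) + 1)

/-- The vector field of the mean-field system of Scheme 1 (join the shortest of the sampled
queues). -/
def driftOne {M : ℕ} (lam mu : ℝ) (γ C : Fin M → ℝ) (d : Fin M → ℕ)
    (u : Fin M → ℕ → ℝ) (j : Fin M) : ℕ → ℝ
  | 0 => 0
  | k + 1 =>
      lam / γ j * (u j k ^ d j - u j (k + 1) ^ d j)
          * (∏ i ∈ Finset.Iio j, u i k ^ d i)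
          * (∏ i ∈ Finset.Ioi j, u i (k + 1) ^ d i)
        - mu * C j * (u j (k + 1) - u j (k + 2))

/-- The vector field of the mean-field system of Scheme 2 (join the sampled server with the
highest processing rate per job). -/
def driftTwo {M : ℕ} (lam mu : ℝ) (γ C : Fin M → ℝ) (d : Fin M → ℕ)
    (u : Fin M → ℕ → ℝ) (j : Fin M) : ℕ → ℝ
  | 0 => 0
  | k + 1 =>
      lam / γ j * (u j k ^ d j - u j (k + 1) ^ d j)
          * (∏ i ∈ Finset.Iio j, u i ⌈C i / C j * (k : ℝ)⌉₊ ^ d i)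
          * (∏ i ∈ Finset.Ioi j, u i (⌊C i / C j * (k : ℝ)⌋₊ + 1) ^ d i)
        - mu * C j * (u j (k + 1) - u j (k + 2))

/-- `u` is a solution on `[0, ∞)`, lying in `Ū^M`, of `u' = F(u)`, `u(0) = g`, the derivative
being taken in each coordinate (one-sided at time `0`). -/
structure IsMeanFieldSolution {M : ℕ} (F : (Fin M → ℕ → ℝ) → Fin M → ℕ → ℝ)
    (g : Fin M → ℕ → ℝ) (u : ℝ → Fin M → ℕ → ℝ) : Prop where
  init : u 0 = g
  mem : ∀ t : ℝ, 0 ≤ t → u t ∈ tailSpaceBar M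
  deriv : ∀ t : ℝ, 0 ≤ t → ∀ (j : Fin M) (k : ℕ),
    HasDerivWithinAt (fun s => u s j k) (F (u t) j k) (Set.Ici 0) t

/-- `P` is an equilibrium point in `U^M` of `u' = F(u)`. -/
def IsEquilibrium {M : ℕ} (F : (Fin M → ℕ → ℝ) → Fin M → ℕ → ℝ)
    (P : Fin M → ℕ → ℝ) : Prop :=
  P ∈ tailSpace M ∧ ∀ j k, F P j k = 0

/-- For every initial point in `U^M` the system `u' = F(u)` has a solution, it is unique, and it
converges to `P` as `t → ∞`. -/
def AllSolutionsConverge {M : ℕ} (F : (Fin M → ℕ → ℝ) → Fin M → ℕ → ℝ)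
    (P : Fin M → ℕ → ℝ) : Prop :=
  ∀ g ∈ tailSpace M, ∃ u : ℝ → Fin M → ℕ → ℝ, IsMeanFieldSolution F g u ∧
    (∀ w : ℝ → Fin M → ℕ → ℝ, IsMeanFieldSolution F g w → Set.EqOn w u (Set.Ici 0)) ∧
    Tendsto (fun t => tailDist (u t) P) atTop (𝓝 0)

/-- Lyapunov stability of `P` with respect to initial points in `U^M`. -/
def IsLyapunovStable {M : ℕ} (F : (Fin M → ℕ → ℝ) → Fin M → ℕ → ℝ)
    (P : Fin M → ℕ → ℝ) : Prop :=
  ∀ ε > 0, ∃ δ > 0, ∀ g ∈ tailSpace M, tailDist g P < δ →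
    ∀ u : ℝ → Fin M → ℕ → ℝ, IsMeanFieldSolution F g u →
      ∀ t : ℝ, 0 ≤ t → tailDist (u t) P < ε

/-- Global asymptotic stability of `P` in `U^M`: Lyapunov stability together with attraction of
every solution that starts in `U^M` (such solutions exist and are unique). -/
def IsGloballyAsymptoticallyStable {M : ℕ} (F : (Fin M → ℕ → ℝ) → Fin M → ℕ → ℝ)
    (P : Fin M → ℕ → ℝ) : Prop :=
  IsLyapunovStable F P ∧ AllSolutionsConverge F P

end

/-!
Both schemes send an arrival to a sampled server with the least `n / a j`, ties being broken towards
larger types, where `n` is the queue length and `j` the type of the server: Scheme 1 has `a = 1` and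
Scheme 2 has `a = C`. So one proof, for arbitrary weights `a > 0`, covers both; the parameters are
collected in `QueueModel`.

Two properties of the vector field carry the argument. It is quasimonotone: for a large constant `A`
the map `Φ u = A u + drift u` is increasing, Lipschitz for the supremum norm, and maps the state
space into `A` times itself (`shifted_mono`, `shifted_le_add`, `shifted_succ_le`). Hence solutions
exist, as limits of increasing Picard iterates of `u' = Φ u - A u`, and are ordered like their
initial states (`exists_solution`, `le_of_subsolution_of_supersolution`). Moreover the arrivals
telescope along the preference order of the dispatcher, so that the mass between two thresholds
`x ≤ n / a j < y` changes only through the flows at `x` and `y` (`sum_drift_eq`).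

The solution that starts without jobs increases, hence converges to an equilibrium `P`. Since the
mass beyond each threshold never decreased along it, the flow into the region beyond a threshold
is at least the flow out of it, and the condition `lam < mu * ∑ j, γ j * C j` turns this into
geometric decay of `P` (`summable_of_outflow_le`).

A solution from `g` lies between the solution without initial jobs, which converges to `P`, and the
solution from `g ⊔ P`. For the latter the excess `u - P` is nonnegative, and the flow identity
bounds `∫ (u - P)` at each level by the same integrals at lower levels plus the initial mass
(`integral_sub_le`); by Barbalat's lemma the excess tends to `0`. This gives convergence and the
uniqueness of the equilibrium.

Lyapunov stability from below holds because the missing mass `P - u` of a solution below `P` does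
not increase, and because `P` is summable. From above the mass cannot be used, since `g` may have an
arbitrarily long thin tail. Instead, let a fraction `η` of the servers start with infinitely many
jobs: the solution increases to an equilibrium of infinite mass, which lies strictly above `P`, is at
least `η` everywhere, and hence dominates a neighbourhood of `P`; these equilibria tend to `P` as
`η` tends to `0`, by uniqueness (`exists_equilibrium_above`, `lt_of_equilibrium_above`).
-/

/-! ### The state space -/

theorem zero_le_of_mem_tailSpaceBar {M : ℕ} {u : Fin M → ℕ → ℝ} (hu : u ∈ tailSpaceBar M)
    (j : Fin M) (n : ℕ) : 0 ≤ u j n := by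
  cases n with
  | zero => rw [(hu j).1]; exact zero_le_one
  | succ n => exact ((hu j).2 n).2

theorem antitone_of_mem_tailSpaceBar {M : ℕ} {u : Fin M → ℕ → ℝ} (hu : u ∈ tailSpaceBar M)
    (j : Fin M) : Antitone (u j) :=
  antitone_nat_of_succ_le fun n => ((hu j).2 n).1

theorem le_one_of_mem_tailSpaceBar {M : ℕ} {u : Fin M → ℕ → ℝ} (hu : u ∈ tailSpaceBar M)
    (j : Fin M) (n : ℕ) : u j n ≤ 1 :=
  (hu j).1 ▸ antitone_of_mem_tailSpaceBar hu j (Nat.zero_le n)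

theorem sup_mem_tailSpaceBar {M : ℕ} {u w : Fin M → ℕ → ℝ} (hu : u ∈ tailSpaceBar M)
    (hw : w ∈ tailSpaceBar M) : u ⊔ w ∈ tailSpaceBar M := fun j =>
  ⟨by simp [(hu j).1, (hw j).1], fun n =>
    ⟨sup_le_sup ((hu j).2 n).1 ((hw j).2 n).1, le_sup_of_le_left ((hu j).2 n).2⟩⟩

theorem inf_mem_tailSpaceBar {M : ℕ} {u w : Fin M → ℕ → ℝ} (hu : u ∈ tailSpaceBar M)
    (hw : w ∈ tailSpaceBar M) : u ⊓ w ∈ tailSpaceBar M := fun j =>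
  ⟨by simp [(hu j).1, (hw j).1], fun n =>
    ⟨inf_le_inf ((hu j).2 n).1 ((hw j).2 n).1, le_inf ((hu j).2 n).2 ((hw j).2 n).2⟩⟩

theorem isClosed_tailSpaceBar (M : ℕ) : IsClosed (tailSpaceBar M) := by
  simp only [tailSpaceBar, Set.ofPred_forall, Set.ofPred_and]
  refine isClosed_iInter fun j => (isClosed_eq (by fun_prop) (by fun_prop)).inter
    (isClosed_iInter fun n => (isClosed_le (by fun_prop) (by fun_prop)).inter
      (isClosed_le (by fun_prop) (by fun_prop)))

/-! ### Differences of powers and products of numbers in the unit interval -/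

theorem pow_sub_pow_le_mul {x y : ℝ} (hx : 0 ≤ x) (hxy : x ≤ y) (hy : y ≤ 1) (n : ℕ) :
    y ^ n - x ^ n ≤ n * (y - x) := by
  induction n with
  | zero => simp
  | succ n ih =>
    have h1 : x ^ n ≤ 1 := pow_le_one₀ hx (hxy.trans hy)
    have h2 : 0 ≤ y ^ n - x ^ n := sub_nonneg.2 (pow_le_pow_left₀ hx hxy n)
    have h3 : y ^ (n + 1) - x ^ (n + 1) = y * (y ^ n - x ^ n) + x ^ n * (y - x) := by ring
    push_cast
    nlinarith [mul_le_mul_of_nonneg_right hy h2,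
      mul_le_mul_of_nonneg_right h1 (sub_nonneg.2 hxy)]

theorem prod_sub_prod_le_sum {ι : Type*} (s : Finset ι) {x y : ι → ℝ} (hx : ∀ i, 0 ≤ x i)
    (hxy : ∀ i, x i ≤ y i) (hy : ∀ i, y i ≤ 1) :
    ∏ i ∈ s, y i - ∏ i ∈ s, x i ≤ ∑ i ∈ s, (y i - x i) := by
  classical
  induction s using Finset.induction_on with
  | empty => simp
  | insert i s hi ih =>
    rw [Finset.prod_insert hi, Finset.prod_insert hi, Finset.sum_insert hi]
    have h1 : ∏ i ∈ s, x i ≤ 1 := Finset.prod_le_one (fun i _ => hx i)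
      fun i _ => (hxy i).trans (hy i)
    have h2 : 0 ≤ ∏ i ∈ s, y i - ∏ i ∈ s, x i :=
      sub_nonneg.2 (Finset.prod_le_prod (fun i _ => hx i) fun i _ => hxy i)
    nlinarith [mul_le_mul_of_nonneg_right (hy i) h2,
      mul_le_mul_of_nonneg_right h1 (sub_nonneg.2 (hxy i))]

theorem prod_pow_sub_prod_pow_le {M : ℕ} (s : Finset (Fin M)) (d : Fin M → ℕ)
    {x y : Fin M → ℝ} (hx : ∀ i, 0 ≤ x i) (hxy : ∀ i, x i ≤ y i) (hy : ∀ i, y i ≤ 1) :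
    ∏ i ∈ s, y i ^ d i - ∏ i ∈ s, x i ^ d i ≤ ∑ i, d i * (y i - x i) :=
  calc _ ≤ ∑ i ∈ s, (y i ^ d i - x i ^ d i) :=
        prod_sub_prod_le_sum s (fun i => pow_nonneg (hx i) _)
          (fun i => pow_le_pow_left₀ (hx i) (hxy i) _)
          (fun i => pow_le_one₀ ((hx i).trans (hxy i)) (hy i))
    _ ≤ ∑ i ∈ s, d i * (y i - x i) :=
        Finset.sum_le_sum fun i _ => pow_sub_pow_le_mul (hx i) (hxy i) (hy i) _
    _ ≤ _ := Finset.sum_le_univ_sum_of_nonneg fun i =>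
        mul_nonneg (Nat.cast_nonneg _) (sub_nonneg.2 (hxy i))

/-! ### The common form of the two schemes -/

/-- The parameters of the mean field of a dispatching rule that sends an arrival to a sampled
server with the least value of `n / a j`, where `n` is the number of jobs and `j` the type of the
server, ties being broken towards larger types. Scheme 1 is `a = 1` and Scheme 2 is `a = C`. -/
structure QueueModel (M : ℕ) where
  /-- the normalised arrival rate -/
  lam : ℝ
  /-- the reciprocal of the mean job length -/
  mu : ℝ
  /-- the proportions of the types -/
  γ : Fin M → ℝ
  /-- the capacities of the types -/
  C : Fin M → ℝ
  /-- the weights by which the dispatcher divides queue lengths -/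
  a : Fin M → ℝ
  /-- the numbers of sampled servers of each type -/
  d : Fin M → ℕ
  lam_pos : 0 < lam
  mu_pos : 0 < mu
  γ_pos : ∀ j, 0 < γ j
  γ_sum : ∑ j, γ j = 1
  C_pos : ∀ j, 0 < C j
  a_pos : ∀ j, 0 < a j
  one_le_d : ∀ j, 1 ≤ d j
  stable : lam < mu * ∑ j, γ j * C j

namespace QueueModel

variable {M : ℕ} (m : QueueModel M)

/-- The probability that no sampled server of a type other than `j` is preferred to a server of
type `j` with `k` jobs. -/
noncomputable def others (u : Fin M → ℕ → ℝ) (j : Fin M) (k : ℕ) : ℝ :=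
  (∏ i ∈ Finset.Iio j, u i ⌈m.a i / m.a j * (k : ℝ)⌉₊ ^ m.d i)
    * (∏ i ∈ Finset.Ioi j, u i (⌊m.a i / m.a j * (k : ℝ)⌋₊ + 1) ^ m.d i)

/-- The vector field of the mean field of the dispatching rule. -/
noncomputable def drift (u : Fin M → ℕ → ℝ) (j : Fin M) : ℕ → ℝ
  | 0 => 0
  | k + 1 => m.lam / m.γ j * (u j k ^ m.d j - u j (k + 1) ^ m.d j) * m.others u j k
      - m.mu * m.C j * (u j (k + 1) - u j (k + 2))

theorem continuous_drift (j : Fin M) (k : ℕ) : Continuous fun u => m.drift u j k := by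
  cases k with
  | zero => exact continuous_const
  | succ k => unfold drift others; fun_prop

/-- A bound for all rates at which a coordinate can decrease in response to itself. -/
noncomputable def rate : ℝ := ∑ j, (m.lam / m.γ j * m.d j + m.mu * m.C j)

/-- `m.shifted u = m.rate • u + m.drift u`. The system `u' = m.drift u` reads
`u' = m.shifted u - m.rate • u`, and `m.shifted` is monotone. -/
noncomputable def shifted (u : Fin M → ℕ → ℝ) (j : Fin M) (k : ℕ) : ℝ :=
  m.rate * u j k + m.drift u j k

theorem continuous_shifted (j : Fin M) (k : ℕ) : Continuous fun u => m.shifted u j k := by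
  have := m.continuous_drift j k
  unfold shifted; fun_prop

theorem lam_div_pos (j : Fin M) : 0 < m.lam / m.γ j := div_pos m.lam_pos (m.γ_pos j)

theorem mu_mul_pos (j : Fin M) : 0 < m.mu * m.C j := mul_pos m.mu_pos (m.C_pos j)

theorem le_rate (j : Fin M) : m.lam / m.γ j * m.d j + m.mu * m.C j ≤ m.rate :=
  Finset.single_le_sum
    (f := fun j => m.lam / m.γ j * m.d j + m.mu * m.C j)
    (fun j _ => by have := m.lam_div_pos j; have := m.mu_mul_pos j; positivity)
    (Finset.mem_univ j)

theorem rate_nonneg : 0 ≤ m.rate :=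
  Finset.sum_nonneg fun j _ => by
    have := m.lam_div_pos j; have := m.mu_mul_pos j; positivity

variable {m} {u w : Fin M → ℕ → ℝ}

theorem others_nonneg (hu : u ∈ tailSpaceBar M) (j : Fin M) (k : ℕ) : 0 ≤ m.others u j k :=
  mul_nonneg (Finset.prod_nonneg fun _ _ => pow_nonneg (zero_le_of_mem_tailSpaceBar hu _ _) _)
    (Finset.prod_nonneg fun _ _ => pow_nonneg (zero_le_of_mem_tailSpaceBar hu _ _) _)

theorem prod_pow_le_one (hu : u ∈ tailSpaceBar M) (s : Finset (Fin M)) (n : Fin M → ℕ) :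
    ∏ i ∈ s, u i (n i) ^ m.d i ≤ 1 :=
  Finset.prod_le_one (fun _ _ => pow_nonneg (zero_le_of_mem_tailSpaceBar hu _ _) _) fun _ _ =>
    pow_le_one₀ (zero_le_of_mem_tailSpaceBar hu _ _) (le_one_of_mem_tailSpaceBar hu _ _)

theorem prod_pow_nonneg (hu : u ∈ tailSpaceBar M) (s : Finset (Fin M)) (n : Fin M → ℕ) :
    0 ≤ ∏ i ∈ s, u i (n i) ^ m.d i :=
  Finset.prod_nonneg fun _ _ => pow_nonneg (zero_le_of_mem_tailSpaceBar hu _ _) _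

theorem prod_pow_mono (hu : u ∈ tailSpaceBar M) (huw : u ≤ w) (s : Finset (Fin M))
    (n : Fin M → ℕ) : ∏ i ∈ s, u i (n i) ^ m.d i ≤ ∏ i ∈ s, w i (n i) ^ m.d i :=
  Finset.prod_le_prod (fun _ _ => pow_nonneg (zero_le_of_mem_tailSpaceBar hu _ _) _) fun _ _ =>
    pow_le_pow_left₀ (zero_le_of_mem_tailSpaceBar hu _ _) (huw _ _) _

theorem others_le_one (hu : u ∈ tailSpaceBar M) (j : Fin M) (k : ℕ) : m.others u j k ≤ 1 :=
  mul_le_one₀ (prod_pow_le_one hu _ _) (prod_pow_nonneg hu _ _) (prod_pow_le_one hu _ _)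

theorem others_mono (hu : u ∈ tailSpaceBar M) (hw : w ∈ tailSpaceBar M) (huw : u ≤ w)
    (j : Fin M) (k : ℕ) : m.others u j k ≤ m.others w j k :=
  mul_le_mul (prod_pow_mono hu huw _ _) (prod_pow_mono hu huw _ _)
    (prod_pow_nonneg hu _ _) (prod_pow_nonneg hw _ _)

theorem others_sub_le (hu : u ∈ tailSpaceBar M) (hw : w ∈ tailSpaceBar M) (huw : u ≤ w) {b : ℝ}
    (hb : ∀ j k, w j k ≤ u j k + b) (j : Fin M) (k : ℕ) :
    m.others w j k - m.others u j k ≤ 2 * ((∑ i, (m.d i : ℝ)) * b) := by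
  have key : ∀ (s : Finset (Fin M)) (n : Fin M → ℕ),
      ∏ i ∈ s, w i (n i) ^ m.d i - ∏ i ∈ s, u i (n i) ^ m.d i ≤ (∑ i, (m.d i : ℝ)) * b := by
    intro s n
    refine (prod_pow_sub_prod_pow_le s m.d (x := fun i => u i (n i)) (y := fun i => w i (n i))
      (fun _ => zero_le_of_mem_tailSpaceBar hu _ _) (fun _ => huw _ _)
      (fun _ => le_one_of_mem_tailSpaceBar hw _ _)).trans ?_
    rw [Finset.sum_mul]
    refine Finset.sum_le_sum fun i _ => mul_le_mul_of_nonneg_left ?_ (Nat.cast_nonneg _)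
    linarith [hb i (n i)]
  have h1 := key (Finset.Iio j) fun i => ⌈m.a i / m.a j * (k : ℝ)⌉₊
  have h2 := key (Finset.Ioi j) fun i => ⌊m.a i / m.a j * (k : ℝ)⌋₊ + 1
  have p1 := prod_pow_le_one (m := m) hu (Finset.Iio j) fun i => ⌈m.a i / m.a j * (k : ℝ)⌉₊
  have p2 := prod_pow_le_one (m := m) hw (Finset.Ioi j) fun i => ⌊m.a i / m.a j * (k : ℝ)⌋₊ + 1
  have q1 := prod_pow_nonneg (m := m) hu (Finset.Iio j) fun i => ⌈m.a i / m.a j * (k : ℝ)⌉₊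
  have q2 := prod_pow_nonneg (m := m) hw (Finset.Ioi j) fun i => ⌊m.a i / m.a j * (k : ℝ)⌋₊ + 1
  have r1 := prod_pow_mono (m := m) hu huw (Finset.Iio j) fun i => ⌈m.a i / m.a j * (k : ℝ)⌉₊
  have r2 := prod_pow_mono (m := m) hu huw (Finset.Ioi j)
    fun i => ⌊m.a i / m.a j * (k : ℝ)⌋₊ + 1
  unfold others
  nlinarith [mul_le_mul_of_nonneg_left p2 (sub_nonneg.2 r1),
    mul_le_mul_of_nonneg_right p1 (sub_nonneg.2 r2)]

/-- The arrival part of the drift is at most a multiple of the mass at level `k`. -/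
theorem arrival_le (hu : u ∈ tailSpaceBar M) (j : Fin M) (k : ℕ) :
    m.lam / m.γ j * (u j k ^ m.d j - u j (k + 1) ^ m.d j) * m.others u j k
      ≤ m.lam / m.γ j * m.d j * (u j k - u j (k + 1)) := by
  have h0 := zero_le_of_mem_tailSpaceBar hu j (k + 1)
  have h1 := ((hu j).2 k).1
  have h2 := pow_sub_pow_le_mul h0 h1 (le_one_of_mem_tailSpaceBar hu j k) (m.d j)
  have h3 : 0 ≤ u j k ^ m.d j - u j (k + 1) ^ m.d j := sub_nonneg.2 (pow_le_pow_left₀ h0 h1 _)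
  have h4 := m.lam_div_pos j
  calc _ ≤ m.lam / m.γ j * (u j k ^ m.d j - u j (k + 1) ^ m.d j) * 1 := by
        gcongr; exact others_le_one hu j k
    _ = m.lam / m.γ j * (u j k ^ m.d j - u j (k + 1) ^ m.d j) := mul_one _
    _ ≤ m.lam / m.γ j * (m.d j * (u j k - u j (k + 1))) := by gcongr
    _ = _ := by ring

theorem arrival_nonneg (hu : u ∈ tailSpaceBar M) (j : Fin M) (k : ℕ) :
    0 ≤ m.lam / m.γ j * (u j k ^ m.d j - u j (k + 1) ^ m.d j) * m.others u j k :=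
  mul_nonneg (mul_nonneg (m.lam_div_pos j).le (sub_nonneg.2
    (pow_le_pow_left₀ (zero_le_of_mem_tailSpaceBar hu j (k + 1)) ((hu j).2 k).1 _)))
    (others_nonneg hu j k)

theorem neg_departure_le_drift (hu : u ∈ tailSpaceBar M) (j : Fin M) (k : ℕ) :
    -(m.mu * m.C j * (u j k - u j (k + 1))) ≤ m.drift u j k := by
  cases k with
  | zero =>
    have := mul_nonneg (m.mu_mul_pos j).le (sub_nonneg.2 ((hu j).2 0).1)
    simpa [drift] using this
  | succ k =>
    have := arrival_nonneg (m := m) hu j k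
    simp only [drift]
    linarith

theorem shifted_zero (hu : u ∈ tailSpaceBar M) (j : Fin M) : m.shifted u j 0 = m.rate := by
  simp [shifted, drift, (hu j).1]

theorem shifted_nonneg (hu : u ∈ tailSpaceBar M) (j : Fin M) (k : ℕ) :
    0 ≤ m.shifted u j k := by
  have h1 := neg_departure_le_drift (m := m) hu j k
  have h2 := m.le_rate j
  have h3 := m.lam_div_pos j
  have h4 := m.mu_mul_pos j
  have h5 := zero_le_of_mem_tailSpaceBar hu j k
  have h6 := zero_le_of_mem_tailSpaceBar hu j (k + 1)
  have h7 : 0 ≤ m.lam / m.γ j * m.d j := by positivity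
  unfold shifted
  nlinarith [mul_nonneg h4.le h6, mul_nonneg h7 h5, mul_le_mul_of_nonneg_right h2 h5]

theorem shifted_succ_le (hu : u ∈ tailSpaceBar M) (j : Fin M) (k : ℕ) :
    m.shifted u j (k + 1) ≤ m.shifted u j k := by
  have h1 := neg_departure_le_drift (m := m) hu j k
  have h2 := arrival_le (m := m) hu j k
  have h3 := mul_le_mul_of_nonneg_right (m.le_rate j) (sub_nonneg.2 ((hu j).2 k).1)
  have h4 := mul_nonneg (m.mu_mul_pos j).le (sub_nonneg.2 ((hu j).2 (k + 1)).1)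
  have h5 : m.drift u j (k + 1)
      = m.lam / m.γ j * (u j k ^ m.d j - u j (k + 1) ^ m.d j) * m.others u j k
      - m.mu * m.C j * (u j (k + 1) - u j (k + 2)) := rfl
  unfold shifted
  linarith

theorem shifted_le_rate (hu : u ∈ tailSpaceBar M) (j : Fin M) (k : ℕ) :
    m.shifted u j k ≤ m.rate :=
  shifted_zero (m := m) hu j ▸
    antitone_nat_of_succ_le (shifted_succ_le (m := m) hu j) (Nat.zero_le k)

theorem abs_drift_le (hu : u ∈ tailSpaceBar M) (j : Fin M) (k : ℕ) :
    |m.drift u j k| ≤ m.rate := by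
  have h1 := shifted_nonneg (m := m) hu j k
  have h2 := shifted_le_rate (m := m) hu j k
  have h3 := mul_nonneg m.rate_nonneg (zero_le_of_mem_tailSpaceBar hu j k)
  have h4 := mul_le_mul_of_nonneg_left (le_one_of_mem_tailSpaceBar hu j k) m.rate_nonneg
  unfold shifted at h1 h2
  rw [abs_le]
  constructor <;> linarith

/-- A quantitative form of quasimonotonicity: raising the state decreases a component of the drift
only in proportion to the increase of that same coordinate. -/
theorem departure_le_shifted_sub (hu : u ∈ tailSpaceBar M) (hw : w ∈ tailSpaceBar M)
    (huw : u ≤ w) (j : Fin M) (k : ℕ) :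
    m.mu * m.C j * (w j (k + 2) - u j (k + 2))
      ≤ m.shifted w j (k + 1) - m.shifted u j (k + 1) := by
  have hc := m.lam_div_pos j
  have hbr : 0 ≤ w j k ^ m.d j - w j (k + 1) ^ m.d j := sub_nonneg.2
    (pow_le_pow_left₀ (zero_le_of_mem_tailSpaceBar hw j (k + 1)) ((hw j).2 k).1 _)
  have h1 : m.lam / m.γ j * (w j k ^ m.d j - w j (k + 1) ^ m.d j) * m.others u j k
      ≤ m.lam / m.γ j * (w j k ^ m.d j - w j (k + 1) ^ m.d j) * m.others w j k := by
    gcongr; exact others_mono hu hw huw j k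
  have hk : u j k ^ m.d j ≤ w j k ^ m.d j :=
    pow_le_pow_left₀ (zero_le_of_mem_tailSpaceBar hu j k) (huw j k) _
  have h2 : m.lam / m.γ j * (u j k ^ m.d j - w j (k + 1) ^ m.d j) * m.others u j k
      ≤ m.lam / m.γ j * (w j k ^ m.d j - w j (k + 1) ^ m.d j) * m.others u j k := by
    have := others_nonneg (m := m) hu j k
    gcongr
  have h3 := pow_sub_pow_le_mul (zero_le_of_mem_tailSpaceBar hu j (k + 1)) (huw j (k + 1))
    (le_one_of_mem_tailSpaceBar hw j (k + 1)) (m.d j)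
  have h4 : 0 ≤ w j (k + 1) ^ m.d j - u j (k + 1) ^ m.d j := sub_nonneg.2
    (pow_le_pow_left₀ (zero_le_of_mem_tailSpaceBar hu j (k + 1)) (huw j (k + 1)) _)
  have h5 : m.lam / m.γ j * (w j (k + 1) ^ m.d j - u j (k + 1) ^ m.d j) * m.others u j k
      ≤ m.lam / m.γ j * m.d j * (w j (k + 1) - u j (k + 1)) := by
    calc _ ≤ m.lam / m.γ j * (w j (k + 1) ^ m.d j - u j (k + 1) ^ m.d j) * 1 := by
          gcongr; exact others_le_one hu j k
      _ ≤ m.lam / m.γ j * (m.d j * (w j (k + 1) - u j (k + 1))) := by rw [mul_one]; gcongr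
      _ = _ := by ring
  have h6 := mul_le_mul_of_nonneg_right (m.le_rate j) (sub_nonneg.2 (huw j (k + 1)))
  simp only [shifted, drift]
  linarith

theorem shifted_mono (hu : u ∈ tailSpaceBar M) (hw : w ∈ tailSpaceBar M) (huw : u ≤ w) :
    m.shifted u ≤ m.shifted w := by
  intro j k
  cases k with
  | zero => rw [shifted_zero hu, shifted_zero hw]
  | succ k =>
    have := mul_nonneg (m.mu_mul_pos j).le (sub_nonneg.2 (huw j (k + 2)))
    linarith [departure_le_shifted_sub (m := m) hu hw huw j k]

variable (m) in
/-- A Lipschitz constant of `m.shifted` for the supremum norm. -/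
noncomputable def lip : ℝ := 2 * m.rate + ∑ j, m.lam / m.γ j * (2 * ∑ i, (m.d i : ℝ)) + 1

theorem lip_pos : 0 < m.lip := by
  have h1 := m.rate_nonneg
  have h2 : 0 ≤ ∑ j, m.lam / m.γ j * (2 * ∑ i, (m.d i : ℝ)) := Finset.sum_nonneg fun j _ => by
    have := m.lam_div_pos j; positivity
  unfold lip; linarith

theorem shifted_le_add (hu : u ∈ tailSpaceBar M) (hw : w ∈ tailSpaceBar M) (huw : u ≤ w) {b : ℝ}
    (hb0 : 0 ≤ b) (hb : ∀ j k, w j k ≤ u j k + b) (j : Fin M) (k : ℕ) :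
    m.shifted w j k ≤ m.shifted u j k + m.lip * b := by
  cases k with
  | zero =>
    rw [shifted_zero hu, shifted_zero hw]
    have := mul_nonneg (lip_pos (m := m)).le hb0
    linarith
  | succ k =>
    have hc := m.lam_div_pos j
    have hk : w j k ^ m.d j - u j k ^ m.d j ≤ m.d j * b :=
      (pow_sub_pow_le_mul (zero_le_of_mem_tailSpaceBar hu j k) (huw j k)
        (le_one_of_mem_tailSpaceBar hw j k) (m.d j)).trans
        (mul_le_mul_of_nonneg_left (by linarith [hb j k]) (Nat.cast_nonneg _))
    have hk' : u j (k + 1) ^ m.d j ≤ w j (k + 1) ^ m.d j :=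
      pow_le_pow_left₀ (zero_le_of_mem_tailSpaceBar hu j (k + 1)) (huw j (k + 1)) _
    have ho := others_sub_le (m := m) hu hw huw hb j k
    have ho0 := others_nonneg (m := m) hw j k
    have ho1 := others_le_one (m := m) hw j k
    have hom := sub_nonneg.2 (others_mono (m := m) hu hw huw j k)
    have hd0 : 0 ≤ u j k ^ m.d j - u j (k + 1) ^ m.d j := sub_nonneg.2
      (pow_le_pow_left₀ (zero_le_of_mem_tailSpaceBar hu j (k + 1)) ((hu j).2 k).1 _)
    have hd1 : u j k ^ m.d j - u j (k + 1) ^ m.d j ≤ 1 := by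
      have := pow_le_one₀ (n := m.d j) (zero_le_of_mem_tailSpaceBar hu j k)
        (le_one_of_mem_tailSpaceBar hu j k)
      have := pow_nonneg (zero_le_of_mem_tailSpaceBar hu j (k + 1)) (m.d j)
      linarith
    have hdb : 0 ≤ m.d j * b := by positivity
    have hmain : (w j k ^ m.d j - w j (k + 1) ^ m.d j) * m.others w j k
        - (u j k ^ m.d j - u j (k + 1) ^ m.d j) * m.others u j k
        ≤ m.d j * b + 2 * ((∑ i, (m.d i : ℝ)) * b) := by
      have e1 : (w j k ^ m.d j - u j k ^ m.d j) * m.others w j k ≤ m.d j * b :=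
        (mul_le_mul_of_nonneg_right hk ho0).trans (mul_le_of_le_one_right hdb ho1)
      have e2 := mul_le_mul_of_nonneg_right hk' ho0
      have e3 := (mul_le_of_le_one_left hom hd1).trans ho
      nlinarith
    have hmain' := mul_le_mul_of_nonneg_left hmain hc.le
    have h3 : m.lam / m.γ j * (2 * ∑ i, (m.d i : ℝ))
        ≤ ∑ j, m.lam / m.γ j * (2 * ∑ i, (m.d i : ℝ)) :=
      Finset.single_le_sum (f := fun j => m.lam / m.γ j * (2 * ∑ i, (m.d i : ℝ)))
        (fun j _ => by have := m.lam_div_pos j; positivity) (Finset.mem_univ j)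
    have h3' := mul_le_mul_of_nonneg_right h3 hb0
    have h4 := mul_le_mul_of_nonneg_right (m.le_rate j) hb0
    have h5 := mul_le_mul_of_nonneg_left (hb j (k + 1)) m.rate_nonneg
    have h6 := mul_le_mul_of_nonneg_left (hb j (k + 2)) (m.mu_mul_pos j).le
    have h7 := mul_le_mul_of_nonneg_left (huw j (k + 1)) (m.mu_mul_pos j).le
    simp only [shifted, drift, lip]
    linarith

end QueueModel

namespace QueueModel

variable {M : ℕ} (m : QueueModel M)

/-! ### Balance of the flow across a threshold -/

/-- The least number of jobs `n` of a server of type `j` with `x ≤ n / a j`. -/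
noncomputable def level (x : ℝ) (j : Fin M) : ℕ := ⌈m.a j * x⌉₊

/-- The probability that all sampled servers have `x ≤ n / a j`, that is, that an arrival joins a
server beyond the threshold `x`. -/
noncomputable def overflow (x : ℝ) (u : Fin M → ℕ → ℝ) : ℝ := ∏ i, u i (m.level x i) ^ m.d i

/-- The departure rate of the servers that have `x ≤ n / a j` after the departure. -/
noncomputable def outflow (x : ℝ) (u : Fin M → ℕ → ℝ) : ℝ :=
  ∑ j, m.γ j * m.C j * u j (m.level x j + 1)

variable {m}

theorem level_mono (j : Fin M) : Monotone fun x => m.level x j := fun _ _ h =>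
  Nat.ceil_mono (mul_le_mul_of_nonneg_left h (m.a_pos j).le)

@[simp] theorem level_zero (j : Fin M) : m.level 0 j = 0 := by simp [level]

theorem level_div (j : Fin M) (n : ℕ) : m.level (n / m.a j) j = n := by
  rw [level, mul_div_cancel₀ _ (m.a_pos j).ne', Nat.ceil_natCast]

theorem sum_Ico_level_eq (u : Fin M → ℕ → ℝ) {y : ℝ} (hy : 0 ≤ y) (j : Fin M) :
    ∑ k ∈ Finset.Ico (m.level y j) (⌊m.a j * y⌋₊ + 1),
        (u j k ^ m.d j - u j (k + 1) ^ m.d j) * m.others u j k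
      = (u j (m.level y j) ^ m.d j - u j (⌊m.a j * y⌋₊ + 1) ^ m.d j)
        * ((∏ i ∈ Finset.Iio j, u i (m.level y i) ^ m.d i)
          * ∏ i ∈ Finset.Ioi j, u i (⌊m.a i * y⌋₊ + 1) ^ m.d i) := by
  have hj := m.a_pos j
  have hjy : 0 ≤ m.a j * y := by positivity
  rcases Nat.lt_or_ge ⌊m.a j * y⌋₊ (m.level y j) with h | h
  · have : m.level y j = ⌊m.a j * y⌋₊ + 1 := le_antisymm (Nat.ceil_le_floor_add_one _) h
    rw [this]; simp
  · have h1 : (m.level y j : ℝ) = m.a j * y := le_antisymm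
      ((Nat.cast_le.2 h).trans (Nat.floor_le hjy)) (Nat.le_ceil _)
    have h2 : ⌊m.a j * y⌋₊ = m.level y j := by rw [← h1, Nat.floor_natCast]
    have h3 : ∀ i, m.a i / m.a j * (m.level y j : ℝ) = m.a i * y := fun i => by
      rw [h1]; field_simp
    rw [h2, Finset.sum_Ico_succ_top le_rfl, Finset.Ico_self, Finset.sum_empty, zero_add]
    simp only [others, h3]
    rfl

/-- The arrivals joining exactly at the threshold `y` make up the jump of the overflow there. -/
theorem overflow_sub_eq (u : Fin M → ℕ → ℝ) {y : ℝ} (hy : 0 ≤ y) :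
    m.overflow y u - ∏ i, u i (⌊m.a i * y⌋₊ + 1) ^ m.d i
      = ∑ j, ∑ k ∈ Finset.Ico (m.level y j) (⌊m.a j * y⌋₊ + 1),
        (u j k ^ m.d j - u j (k + 1) ^ m.d j) * m.others u j k := by
  have h := Finset.prod_sub_ordered Finset.univ
    (fun i => u i (⌊m.a i * y⌋₊ + 1) ^ m.d i)
    (fun i => u i (⌊m.a i * y⌋₊ + 1) ^ m.d i - u i (m.level y i) ^ m.d i)
  simp only [sub_sub_cancel] at h
  rw [overflow, h, sub_sub_cancel_left, ← Finset.sum_neg_distrib]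
  refine Finset.sum_congr rfl fun j _ => ?_
  rw [sum_Ico_level_eq u hy, Finset.filter_gt_eq_Iio, Finset.filter_lt_eq_Ioi]
  ring

/-- The arrivals joining between two thresholds. The sum telescopes along the order in which the
dispatcher prefers servers, that is, along the increasing values of `k / a j`. -/
theorem sum_arrivals_eq (u : Fin M → ℕ → ℝ) {x y : ℝ} (hx : 0 ≤ x) (hxy : x ≤ y) :
    ∑ j, ∑ k ∈ Finset.Ico (m.level x j) (m.level y j),
        (u j k ^ m.d j - u j (k + 1) ^ m.d j) * m.others u j k
      = m.overflow x u - m.overflow y u := by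
  induction hn : ∑ j, m.level y j using Nat.strong_induction_on generalizing y with
  | _ n ih =>
  by_cases hne : ∀ j, m.level y j = m.level x j
  · simp [hne, overflow]
  push Not at hne
  obtain ⟨j₀, hj₀⟩ := hne
  have hlt₀ : m.level x j₀ < m.level y j₀ := lt_of_le_of_ne (level_mono j₀ hxy) (Ne.symm hj₀)
  -- `z` is the last point `k / a j` before `y`
  obtain ⟨⟨j, k⟩, hjk, hmax⟩ := Finset.exists_max_image
    (Finset.univ.sigma fun j => Finset.Ico (m.level x j) (m.level y j))
    (fun p : (_ : Fin M) × ℕ => (p.2 : ℝ) / m.a p.1)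
    ⟨⟨j₀, m.level x j₀⟩, by simp [hlt₀]⟩
  simp only [Finset.mem_sigma, Finset.mem_univ, true_and, Finset.mem_Ico] at hjk hmax
  set z : ℝ := k / m.a j with hz
  have hxz : x ≤ z := by
    rw [hz, le_div_iff₀ (m.a_pos j), mul_comm]; exact Nat.ceil_le.1 hjk.1
  have hzy : z < y := by
    rw [hz, div_lt_iff₀ (m.a_pos j), mul_comm]; exact Nat.lt_ceil.1 hjk.2
  have hz0 : 0 ≤ z := hx.trans hxz
  have hlev : ∀ i, m.level y i = ⌊m.a i * z⌋₊ + 1 := by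
    intro i
    have hi := m.a_pos i
    refine le_antisymm (not_lt.1 fun hlt => ?_) ?_
    · have h1 : m.a i * z < ((⌊m.a i * z⌋₊ + 1 : ℕ) : ℝ) := by
        push_cast; exact Nat.lt_floor_add_one _
      have h2 : m.level x i ≤ ⌊m.a i * z⌋₊ + 1 :=
        (level_mono i hxz).trans (Nat.ceil_le_floor_add_one _)
      have h3 := hmax ⟨i, ⌊m.a i * z⌋₊ + 1⟩ ⟨h2, hlt⟩
      rw [div_le_iff₀ hi, mul_comm z] at h3
      exact absurd h1 (not_lt.2 h3)
    · refine Nat.succ_le_of_lt (Nat.lt_ceil.2 ?_)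
      exact (Nat.floor_le (by positivity)).trans_lt (mul_lt_mul_of_pos_left hzy hi)
  have hle : ∀ i, m.level z i ≤ m.level y i := fun i => level_mono i hzy.le
  have hdecr : ∑ i, m.level z i < n := by
    rw [← hn]
    refine Finset.sum_lt_sum (fun i _ => hle i) ⟨j, Finset.mem_univ j, ?_⟩
    rw [hz, level_div]; exact hjk.2
  have h1 := ih _ hdecr hxz rfl
  have h2 := overflow_sub_eq (m := m) u hz0
  have h3 : m.overflow y u = ∏ i, u i (⌊m.a i * z⌋₊ + 1) ^ m.d i := by simp only [overflow, hlev]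
  rw [← h3] at h2
  have h4 : ∀ i, m.level z i ≤ ⌊m.a i * z⌋₊ + 1 := fun i => hlev i ▸ hle i
  calc _ = ∑ i, (∑ k ∈ Finset.Ico (m.level x i) (m.level z i),
          (u i k ^ m.d i - u i (k + 1) ^ m.d i) * m.others u i k
        + ∑ k ∈ Finset.Ico (m.level z i) (⌊m.a i * z⌋₊ + 1),
          (u i k ^ m.d i - u i (k + 1) ^ m.d i) * m.others u i k) :=
        Finset.sum_congr rfl fun i _ => by
          rw [Finset.sum_Ico_consecutive _ (level_mono i hxz) (h4 i), hlev i]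
    _ = _ := by rw [Finset.sum_add_distrib, h1, ← h2]; ring

/-- The number of jobs beyond the threshold `x` and not beyond `y` changes by the difference of the
arrival rates and the departure rates at the two thresholds. -/
theorem sum_drift_eq (u : Fin M → ℕ → ℝ) {x y : ℝ} (hx : 0 ≤ x) (hxy : x ≤ y) :
    ∑ j, m.γ j * ∑ k ∈ Finset.Ico (m.level x j) (m.level y j), m.drift u j (k + 1)
      = m.lam * (m.overflow x u - m.overflow y u) - m.mu * (m.outflow x u - m.outflow y u) := by
  rw [← sum_arrivals_eq u hx hxy, outflow, outflow, ← Finset.sum_sub_distrib, Finset.mul_sum,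
    Finset.mul_sum, ← Finset.sum_sub_distrib]
  refine Finset.sum_congr rfl fun j _ => ?_
  have hγ := (m.γ_pos j).ne'
  have htel : ∑ k ∈ Finset.Ico (m.level x j) (m.level y j), (u j (k + 1) - u j (k + 2))
      = u j (m.level x j + 1) - u j (m.level y j + 1) := by
    have := Finset.sum_Ico_sub (fun k => u j (k + 1)) (level_mono (m := m) j hxy)
    rw [← neg_inj, ← Finset.sum_neg_distrib]
    simpa using this
  simp only [drift]
  rw [Finset.sum_sub_distrib, ← Finset.mul_sum, htel, mul_sub, Finset.mul_sum, Finset.mul_sum]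
  congr 1
  · exact Finset.sum_congr rfl fun k _ => by field_simp
  · ring

variable {u w : Fin M → ℕ → ℝ}

theorem overflow_zero (hu : u ∈ tailSpaceBar M) : m.overflow 0 u = 1 := by
  simp [overflow, (hu _).1]

theorem overflow_nonneg (hu : u ∈ tailSpaceBar M) (x : ℝ) : 0 ≤ m.overflow x u :=
  prod_pow_nonneg hu _ _

theorem overflow_le_one (hu : u ∈ tailSpaceBar M) (x : ℝ) : m.overflow x u ≤ 1 :=
  prod_pow_le_one hu _ _

theorem overflow_mono (hu : u ∈ tailSpaceBar M) (huw : u ≤ w) (x : ℝ) :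
    m.overflow x u ≤ m.overflow x w :=
  prod_pow_mono hu huw _ _

theorem overflow_le (hu : u ∈ tailSpaceBar M) (x : ℝ) (j : Fin M) :
    m.overflow x u ≤ u j (m.level x j) := by
  have h0 := zero_le_of_mem_tailSpaceBar hu
  have h1 := le_one_of_mem_tailSpaceBar hu
  calc m.overflow x u
      = u j (m.level x j) ^ m.d j * ∏ i ∈ Finset.univ.erase j, u i (m.level x i) ^ m.d i :=
        (Finset.mul_prod_erase _ _ (Finset.mem_univ j)).symm
    _ ≤ u j (m.level x j) ^ m.d j * 1 := by
        gcongr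
        · exact pow_nonneg (h0 _ _) _
        · exact prod_pow_le_one hu _ _
    _ ≤ u j (m.level x j) := by
        rw [mul_one]
        exact pow_le_of_le_one (h0 _ _) (h1 _ _) (Nat.one_le_iff_ne_zero.1 (m.one_le_d j))

theorem outflow_antitone (hu : u ∈ tailSpaceBar M) : Antitone fun x => m.outflow x u := by
  intro x y hxy
  refine Finset.sum_le_sum fun j _ => mul_le_mul_of_nonneg_left ?_
    (mul_nonneg (m.γ_pos j).le (m.C_pos j).le)
  exact antitone_of_mem_tailSpaceBar hu j (Nat.succ_le_succ (level_mono j hxy))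

theorem outflow_mono (huw : u ≤ w) (x : ℝ) : m.outflow x u ≤ m.outflow x w :=
  Finset.sum_le_sum fun j _ => mul_le_mul_of_nonneg_left (huw _ _)
    (mul_nonneg (m.γ_pos j).le (m.C_pos j).le)

theorem outflow_nonneg (hu : u ∈ tailSpaceBar M) (x : ℝ) : 0 ≤ m.outflow x u :=
  Finset.sum_nonneg fun j _ => mul_nonneg (mul_nonneg (m.γ_pos j).le (m.C_pos j).le)
    (zero_le_of_mem_tailSpaceBar hu _ _)

end QueueModel

/-! ### Comparison of solutions -/

theorem le_of_hasDerivWithinAt_le {f g f' g' : ℝ → ℝ}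
    (hf : ∀ t, 0 ≤ t → HasDerivWithinAt f (f' t) (Set.Ici 0) t)
    (hg : ∀ t, 0 ≤ t → HasDerivWithinAt g (g' t) (Set.Ici 0) t)
    (h0 : f 0 ≤ g 0) (h : ∀ t, 0 ≤ t → f' t ≤ g' t) {t : ℝ} (ht : 0 ≤ t) : f t ≤ g t := by
  have hmono : MonotoneOn (fun s => g s - f s) (Set.Ici 0) := by
    refine monotoneOn_of_hasDerivWithinAt_nonneg (f' := fun s => g' s - f' s) (convex_Ici 0)
      (fun s hs => ((hg s hs).sub (hf s hs)).continuousWithinAt) (fun s hs => ?_) fun s hs => ?_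
    · exact ((hg s (interior_subset hs)).sub (hf s (interior_subset hs))).mono interior_subset
    · exact sub_nonneg.2 (h s (interior_subset hs))
  have := hmono Set.self_mem_Ici ht ht
  simp only at this
  linarith

namespace QueueModel

variable {M : ℕ} {m : QueueModel M}

/-- A curve moving at most as fast as the drift stays below a curve moving at least as fast, once
it starts below. If `u - w ≤ b * exp (c * t)` with `c = 2 * m.lip` holds in all coordinates, then
the Lipschitz bound improves this to `b / 2`; iterating gives `u - w ≤ 0`. -/
theorem le_of_subsolution_of_supersolution {u w u' w' : ℝ → Fin M → ℕ → ℝ}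
    (hu : ∀ t, 0 ≤ t → u t ∈ tailSpaceBar M) (hw : ∀ t, 0 ≤ t → w t ∈ tailSpaceBar M)
    (hu' : ∀ t, 0 ≤ t → ∀ j k, HasDerivWithinAt (fun s => u s j k) (u' t j k) (Set.Ici 0) t)
    (hw' : ∀ t, 0 ≤ t → ∀ j k, HasDerivWithinAt (fun s => w s j k) (w' t j k) (Set.Ici 0) t)
    (hsub : ∀ t, 0 ≤ t → u' t ≤ m.drift (u t)) (hsup : ∀ t, 0 ≤ t → m.drift (w t) ≤ w' t)
    (h0 : u 0 ≤ w 0) {t : ℝ} (ht : 0 ≤ t) : u t ≤ w t := by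
  have hL := lip_pos (m := m)
  have hA := m.rate_nonneg
  set L := m.lip
  set A := m.rate
  have key : ∀ n : ℕ, ∀ t, 0 ≤ t → ∀ j k,
      u t j k - w t j k ≤ (1 / 2) ^ n * Real.exp (2 * L * t) := by
    intro n
    induction n with
    | zero =>
      intro t ht j k
      have h1 := le_one_of_mem_tailSpaceBar (hu t ht) j k
      have h2 := zero_le_of_mem_tailSpaceBar (hw t ht) j k
      have h3 := Real.one_le_exp (show 0 ≤ 2 * L * t by positivity)
      simp only [pow_zero, one_mul]
      linarith
    | succ n ih =>
      intro t ht j k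
      have hexp : ∀ c s : ℝ, HasDerivWithinAt (fun s => Real.exp (c * s)) (c * Real.exp (c * s))
          (Set.Ici 0) s := fun c s => by
        have := (((hasDerivAt_id s).const_mul c).exp).hasDerivWithinAt (s := Set.Ici 0)
        simpa [mul_comm] using this
      have h1 := le_of_hasDerivWithinAt_le
        (f := fun s => Real.exp (A * s) * (u s j k - w s j k))
        (g := fun s => (1 / 2) ^ (n + 1) * Real.exp ((A + 2 * L) * s))
        (fun s hs => (hexp A s).mul ((hu' s hs j k).sub (hw' s hs j k)))
        (fun s hs => (hexp (A + 2 * L) s).const_mul _)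
        (by
          have : u 0 j k - w 0 j k ≤ 0 := sub_nonpos.2 (h0 j k)
          simp only [mul_zero, Real.exp_zero, one_mul, mul_one]
          exact this.trans (by positivity))
        (fun s hs => by
          have hb : 0 ≤ (1 / 2 : ℝ) ^ n * Real.exp (2 * L * s) := by positivity
          have e1 := shifted_mono (m := m) (hu s hs) (sup_mem_tailSpaceBar (hu s hs) (hw s hs))
            le_sup_left j k
          have e2 := shifted_le_add (m := m) (hw s hs)
            (sup_mem_tailSpaceBar (hu s hs) (hw s hs)) le_sup_right hb
            (fun j k => sup_le (by linarith [ih s hs j k]) (by linarith)) j k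
          have e3 := hsub s hs j k
          have e4 := hsup s hs j k
          have e5 : A * (u s j k - w s j k) + (u' s j k - w' s j k)
              ≤ L * ((1 / 2 : ℝ) ^ n * Real.exp (2 * L * s)) := by
            unfold shifted at e1 e2
            linarith
          have e6 := mul_le_mul_of_nonneg_left e5 (Real.exp_pos (A * s)).le
          have e7 : Real.exp ((A + 2 * L) * s) = Real.exp (A * s) * Real.exp (2 * L * s) := by
            rw [← Real.exp_add]; ring_nf
          have e8 : 0 ≤ (1 / 2 : ℝ) ^ n * A * Real.exp (A * s) * Real.exp (2 * L * s) := by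
            positivity
          rw [e7, pow_succ]
          linarith) ht
      have h2 : Real.exp ((A + 2 * L) * t) = Real.exp (A * t) * Real.exp (2 * L * t) := by
        rw [← Real.exp_add]; ring_nf
      simp only [h2] at h1
      refine le_of_mul_le_mul_left ?_ (Real.exp_pos (A * t))
      linarith
  intro j k
  have hlim : Tendsto (fun n : ℕ => (1 / 2 : ℝ) ^ n * Real.exp (2 * L * t)) atTop (𝓝 0) := by
    simpa using (tendsto_pow_atTop_nhds_zero_of_lt_one (r := (1 / 2 : ℝ)) (by norm_num)
      (by norm_num)).mul_const (Real.exp (2 * L * t))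
  exact sub_nonpos.1 (ge_of_tendsto' hlim fun n => key n t ht j k)

variable {g g' : Fin M → ℕ → ℝ} {u w : ℝ → Fin M → ℕ → ℝ}

theorem solution_le_solution (hu : IsMeanFieldSolution m.drift g u)
    (hw : IsMeanFieldSolution m.drift g' w) (h : g ≤ g') {t : ℝ} (ht : 0 ≤ t) : u t ≤ w t :=
  le_of_subsolution_of_supersolution (m := m) hu.mem hw.mem hu.deriv hw.deriv (fun _ _ => le_rfl)
    (fun _ _ => le_rfl) (by rwa [hu.init, hw.init]) ht

theorem subsolution_le_solution (hu : IsMeanFieldSolution m.drift g u) (hg' : g' ∈ tailSpaceBar M)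
    (hsub : 0 ≤ m.drift g') (h : g' ≤ g) {t : ℝ} (ht : 0 ≤ t) : g' ≤ u t :=
  le_of_subsolution_of_supersolution (m := m) (u := fun _ => g') (u' := 0) (fun _ _ => hg') hu.mem
    (fun _ _ _ _ => hasDerivWithinAt_const _ _ _) hu.deriv (fun _ _ => hsub)
    (fun _ _ => le_rfl) (by rwa [hu.init]) ht

theorem isMeanFieldSolution_const (hg : g ∈ tailSpaceBar M) (h : ∀ j k, m.drift g j k = 0) :
    IsMeanFieldSolution m.drift g fun _ => g where
  init := rfl
  mem _ _ := hg
  deriv _ _ j k := by rw [h j k]; exact hasDerivWithinAt_const _ _ _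

theorem solution_unique (hu : IsMeanFieldSolution m.drift g u)
    (hw : IsMeanFieldSolution m.drift g w) : Set.EqOn w u (Set.Ici 0) := fun _ ht =>
  le_antisymm (solution_le_solution hw hu le_rfl ht) (solution_le_solution hu hw le_rfl ht)

theorem solution_shift (hu : IsMeanFieldSolution m.drift g u) {s : ℝ} (hs : 0 ≤ s) :
    IsMeanFieldSolution m.drift (u s) fun t => u (t + s) where
  init := by simp
  mem t ht := hu.mem _ (add_nonneg ht hs)
  deriv t ht j k := by
    have h1 := hu.deriv (t + s) (add_nonneg ht hs) j k
    have h2 : HasDerivWithinAt (fun t : ℝ => t + s) 1 (Set.Ici 0) t :=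
      ((hasDerivAt_id t).add_const s).hasDerivWithinAt
    have h3 := h1.scomp t h2 (fun x (hx : 0 ≤ x) => add_nonneg hx hs)
    simpa [Function.comp_def] using h3

theorem solution_monotone (hu : IsMeanFieldSolution m.drift g u) (hg : g ∈ tailSpaceBar M)
    (hsub : 0 ≤ m.drift g) : MonotoneOn u (Set.Ici 0) := by
  intro s hs t _ hst
  have h := solution_le_solution hu (solution_shift hu (sub_nonneg.2 hst))
    (subsolution_le_solution hu hg hsub le_rfl (sub_nonneg.2 hst)) hs
  simpa using h

end QueueModel

/-! ### Existence of solutions -/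

/-- The state with value `1` at level `0` and `η` at all other levels: of the servers of each type a
fraction `η` has infinitely many jobs and the others have none. -/
noncomputable def flatState (M : ℕ) (η : ℝ) : Fin M → ℕ → ℝ := fun _ k => if k = 0 then 1 else η

theorem flatState_mem_tailSpaceBar {M : ℕ} {η : ℝ} (h0 : 0 ≤ η) (h1 : η ≤ 1) :
    flatState M η ∈ tailSpaceBar M := by
  intro j
  refine ⟨by simp [flatState], fun n => ⟨?_, by simp [flatState, h0]⟩⟩
  cases n <;> simp [flatState, h1]

theorem flatState_le {M : ℕ} {η : ℝ} {u : Fin M → ℕ → ℝ} (hu : u ∈ tailSpaceBar M)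
    (h : ∀ j k, η ≤ u j k) : flatState M η ≤ u := by
  intro j k
  by_cases hk : k = 0
  · simp [flatState, hk, (hu j).1]
  · simpa [flatState, hk] using h j k

namespace QueueModel

open MeasureTheory intervalIntegral

variable {M : ℕ} (m : QueueModel M)

/-- The right-hand side of the integral form `u t = exp (-A t) (g + ∫ exp (A s) Φ (u s))` of the
mean-field system, where `A = m.rate` and `Φ = m.shifted`. -/
noncomputable def duhamel (g : Fin M → ℕ → ℝ) (v : ℝ → Fin M → ℕ → ℝ) (t : ℝ) (j : Fin M)
    (k : ℕ) : ℝ :=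
  Real.exp (-(m.rate * t)) *
    (g j k + ∫ s in (0 : ℝ)..t, Real.exp (m.rate * s) * m.shifted (v s) j k)

/-- The Picard iterates of `m.duhamel`, starting from the least state. They increase. -/
noncomputable def picard (g : Fin M → ℕ → ℝ) : ℕ → ℝ → Fin M → ℕ → ℝ
  | 0 => fun _ => flatState M 0
  | n + 1 => m.duhamel g (picard g n)

variable {m} {g : Fin M → ℕ → ℝ} {v w : ℝ → Fin M → ℕ → ℝ}

theorem norm_exp_mul_shifted_le {u : Fin M → ℕ → ℝ} (hu : u ∈ tailSpaceBar M) (j : Fin M) (k : ℕ)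
    (s : ℝ) :
    ‖Real.exp (m.rate * s) * m.shifted u j k‖ ≤ Real.exp (m.rate * s) * m.rate := by
  rw [Real.norm_eq_abs, abs_mul, Real.abs_exp, abs_of_nonneg (shifted_nonneg hu j k)]
  gcongr
  exact shifted_le_rate hu j k

theorem intervalIntegrable_shifted (hv : Measurable v) (hmem : ∀ t, 0 ≤ t → v t ∈ tailSpaceBar M)
    (j : Fin M) (k : ℕ) {a b : ℝ} (ha : 0 ≤ a) (hb : 0 ≤ b) :
    IntervalIntegrable (fun s => Real.exp (m.rate * s) * m.shifted (v s) j k) volume a b := by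
  have hbound : Continuous fun s => Real.exp (m.rate * s) * m.rate := by fun_prop
  refine (hbound.intervalIntegrable a b).mono_fun' ?_ ?_
  · have h1 : Measurable fun s => m.shifted (v s) j k :=
      (m.continuous_shifted j k).measurable.comp hv
    have h2 : Measurable fun s => Real.exp (m.rate * s) := by fun_prop
    exact (h2.mul h1).aestronglyMeasurable
  · refine (ae_restrict_iff' measurableSet_uIoc).2 (ae_of_all _ fun s hs => ?_)
    have hs0 : 0 ≤ s := (le_min ha hb).trans hs.1.le
    exact norm_exp_mul_shifted_le (hmem s hs0) j k s

theorem duhamel_mem (hv : Measurable v) (hmem : ∀ t, 0 ≤ t → v t ∈ tailSpaceBar M)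
    (hg : g ∈ tailSpaceBar M) {t : ℝ} (ht : 0 ≤ t) : m.duhamel g v t ∈ tailSpaceBar M := by
  intro j
  have hE := (Real.exp_pos (-(m.rate * t))).le
  have hcongr : ∀ k, IntervalIntegrable _ volume 0 t := fun k =>
    intervalIntegrable_shifted (m := m) hv hmem j k le_rfl ht
  refine ⟨?_, fun k => ⟨?_, ?_⟩⟩
  · have h1 : ∫ s in (0 : ℝ)..t, Real.exp (m.rate * s) * m.shifted (v s) j 0
        = ∫ s in (0 : ℝ)..t, Real.exp (m.rate * s) * m.rate :=
      integral_congr fun s hs => by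
        rw [Set.uIcc_of_le ht] at hs
        simp only [shifted_zero (hmem s hs.1)]
    have h2 : ∫ s in (0 : ℝ)..t, Real.exp (m.rate * s) * m.rate
        = Real.exp (m.rate * t) - Real.exp (m.rate * 0) :=
      integral_eq_sub_of_hasDerivAt
        (fun s _ => by
          have := ((hasDerivAt_id s).const_mul m.rate).exp
          simpa using this)
        (Continuous.intervalIntegrable (by fun_prop) _ _)
    rw [duhamel, h1, h2, (hg j).1, mul_zero, Real.exp_zero, add_sub_cancel, ← Real.exp_add]
    simp
  · refine mul_le_mul_of_nonneg_left (add_le_add ((hg j).2 k).1 ?_) hE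
    exact integral_mono_on ht (hcongr _) (hcongr _) fun s hs =>
      mul_le_mul_of_nonneg_left (shifted_succ_le (hmem s hs.1) j k) (Real.exp_pos _).le
  · refine mul_nonneg hE (add_nonneg ((hg j).2 k).2 ?_)
    exact integral_nonneg ht fun s hs =>
      mul_nonneg (Real.exp_pos _).le (shifted_nonneg (hmem s hs.1) j _)

theorem duhamel_mono (hv : Measurable v) (hw : Measurable w)
    (hvm : ∀ t, 0 ≤ t → v t ∈ tailSpaceBar M) (hwm : ∀ t, 0 ≤ t → w t ∈ tailSpaceBar M)
    (h : ∀ t, 0 ≤ t → v t ≤ w t) {t : ℝ} (ht : 0 ≤ t) : m.duhamel g v t ≤ m.duhamel g w t := by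
  intro j k
  refine mul_le_mul_of_nonneg_left (add_le_add le_rfl ?_) (Real.exp_pos _).le
  exact integral_mono_on ht (intervalIntegrable_shifted hv hvm j k le_rfl ht)
    (intervalIntegrable_shifted hw hwm j k le_rfl ht) fun s hs =>
    mul_le_mul_of_nonneg_left (shifted_mono (hvm s hs.1) (hwm s hs.1) (h s hs.1) j k)
      (Real.exp_pos _).le

theorem hasDerivAt_duhamel (hv : Continuous v) (t : ℝ) (j : Fin M) (k : ℕ) :
    HasDerivAt (fun t => m.duhamel g v t j k)
      (m.shifted (v t) j k - m.rate * m.duhamel g v t j k) t := by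
  have hcont : Continuous fun s => Real.exp (m.rate * s) * m.shifted (v s) j k :=
    (by fun_prop : Continuous fun s => Real.exp (m.rate * s)).mul
      ((m.continuous_shifted j k).comp hv)
  have h1 := (integral_hasDerivAt_right (hcont.intervalIntegrable 0 t)
    (hcont.stronglyMeasurableAtFilter _ _) hcont.continuousAt).const_add (g j k)
  have h2 := (((hasDerivAt_id t).const_mul m.rate).neg).exp
  have h3 := h2.mul h1
  have h4 : Real.exp (-(m.rate * t)) * Real.exp (m.rate * t) = 1 := by
    rw [← Real.exp_add]; simp
  convert! h3 using 1
  simp only [duhamel, Pi.neg_apply, id]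
  linear_combination (-m.shifted (v t) j k) * h4

theorem continuous_picard (n : ℕ) : Continuous (m.picard g n) := by
  induction n with
  | zero => exact continuous_const
  | succ n ih =>
    exact continuous_pi fun j => continuous_pi fun k =>
      continuous_iff_continuousAt.2 fun t => (hasDerivAt_duhamel ih t j k).continuousAt

theorem picard_mem (hg : g ∈ tailSpaceBar M) (n : ℕ) :
    ∀ t, 0 ≤ t → m.picard g n t ∈ tailSpaceBar M := by
  induction n with
  | zero => exact fun _ _ => flatState_mem_tailSpaceBar le_rfl zero_le_one
  | succ n ih => exact fun t ht => duhamel_mem (continuous_picard n).measurable ih hg ht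

theorem picard_le_succ (hg : g ∈ tailSpaceBar M) (n : ℕ) :
    ∀ t, 0 ≤ t → m.picard g n t ≤ m.picard g (n + 1) t := by
  induction n with
  | zero =>
    exact fun t ht => flatState_le (picard_mem hg 1 t ht)
      (zero_le_of_mem_tailSpaceBar (picard_mem hg 1 t ht))
  | succ n ih =>
    exact fun t ht => duhamel_mono (continuous_picard n).measurable
      (continuous_picard (n + 1)).measurable (picard_mem hg n) (picard_mem hg (n + 1)) ih ht

theorem exists_solution (hg : g ∈ tailSpaceBar M) : ∃ u, IsMeanFieldSolution m.drift g u := by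
  set v : ℝ → Fin M → ℕ → ℝ := fun t j k => ⨆ n, m.picard g n (max t 0) j k with hv
  have hmono : ∀ t, 0 ≤ t → ∀ j k, Monotone fun n => m.picard g n t j k := fun t ht j k =>
    monotone_nat_of_le_succ fun n => picard_le_succ hg n t ht j k
  have hlim : ∀ t, Tendsto (fun n => m.picard g n (max t 0)) atTop (𝓝 (v t)) := fun t =>
    tendsto_pi_nhds.2 fun j => tendsto_pi_nhds.2 fun k =>
      tendsto_atTop_ciSup (hmono _ (le_max_right t 0) j k) ⟨1, by
        rintro _ ⟨n, rfl⟩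
        exact le_one_of_mem_tailSpaceBar (picard_mem hg n _ (le_max_right t 0)) j k⟩
  have hlim' : ∀ t, 0 ≤ t → Tendsto (fun n => m.picard g n t) atTop (𝓝 (v t)) := fun t ht => by
    simpa [max_eq_left ht] using hlim t
  have hmem : ∀ t, v t ∈ tailSpaceBar M := fun t =>
    (isClosed_tailSpaceBar M).mem_of_tendsto (hlim t)
      (Eventually.of_forall fun n => picard_mem hg n _ (le_max_right t 0))
  have hmeas : Measurable v := measurable_of_tendsto_metrizable
    (fun n => ((continuous_picard (m := m) (g := g) n).comp (by fun_prop)).measurable)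
    (tendsto_pi_nhds.2 hlim)
  have hfix : ∀ t, 0 ≤ t → v t = m.duhamel g v t := by
    intro t ht
    refine tendsto_nhds_unique ((tendsto_add_atTop_iff_nat 1).2 (hlim' t ht)) ?_
    refine tendsto_pi_nhds.2 fun j => tendsto_pi_nhds.2 fun k =>
      ((intervalIntegral.tendsto_integral_filter_of_dominated_convergence
        (fun s => Real.exp (m.rate * s) * m.rate) ?_ ?_ ?_ ?_).const_add _).const_mul _
    · exact Eventually.of_forall fun n => (intervalIntegrable_shifted
        (continuous_picard n).measurable (picard_mem hg n) j k le_rfl ht).def'.aestronglyMeasurable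
    · refine Eventually.of_forall fun n => ae_of_all _ fun s hs => ?_
      have hs0 : 0 ≤ s := by rw [Set.uIoc_of_le ht] at hs; exact hs.1.le
      exact norm_exp_mul_shifted_le (picard_mem hg n s hs0) j k s
    · exact Continuous.intervalIntegrable (by fun_prop) _ _
    · refine ae_of_all _ fun s hs => ?_
      have hs0 : 0 ≤ s := by rw [Set.uIoc_of_le ht] at hs; exact hs.1.le
      exact (((m.continuous_shifted j k).tendsto _).comp (hlim' s hs0)).const_mul _
  have hmax : ∀ t, v t = v (max t 0) := fun t => by simp [hv]
  have hcont : Continuous v := by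
    have h1 : ∀ j k, Continuous fun t => m.duhamel g v (max t 0) j k := by
      intro j k
      -- `v` is constant on `(-∞, 0]`, so the bound on the integrand holds on both sides of `0`
      have h2 : Continuous fun t => ∫ s in (0 : ℝ)..t,
          Real.exp (m.rate * s) * m.shifted (v s) j k := by
        refine continuous_primitive (fun a b => ?_) 0
        have hbound : Continuous fun s => Real.exp (m.rate * s) * m.rate := by fun_prop
        refine (hbound.intervalIntegrable a b).mono_fun' ?_ (ae_of_all _ fun s => ?_)
        · have h3 : Measurable fun s => m.shifted (v s) j k :=
            (m.continuous_shifted j k).measurable.comp hmeas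
          have h4 : Measurable fun s => Real.exp (m.rate * s) := by fun_prop
          exact (h4.mul h3).aestronglyMeasurable
        · exact norm_exp_mul_shifted_le (hmem s) j k s
      unfold duhamel
      have h5 := h2.comp (by fun_prop : Continuous fun t : ℝ => max t 0)
      simp only [Function.comp_def] at h5
      fun_prop
    have h6 : v = fun t => m.duhamel g v (max t 0) := by
      ext t : 1
      rw [hmax t]; exact hfix _ (le_max_right t 0)
    rw [h6]
    exact continuous_pi fun j => continuous_pi fun k => h1 j k
  refine ⟨m.duhamel g v, ?_, fun t ht => hfix t ht ▸ hmem t, fun t ht j k => ?_⟩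
  · ext j k; simp [duhamel]
  · have h := (hasDerivAt_duhamel (m := m) (g := g) hcont t j k).hasDerivWithinAt
      (s := Set.Ici 0)
    have h7 := hfix t ht
    rw [← h7, h7] at h
    rw [← h7] at h
    simpa [shifted, ← h7] using h

end QueueModel

/-! ### Summability and limits on the half-line -/

theorem summable_of_antitone_of_le_geometric {f : ℕ → ℝ} (hf : Antitone f) (h0 : ∀ n, 0 ≤ f n)
    {B : ℕ} (hB : 1 ≤ B) {K ρ : ℝ} (hK : 0 ≤ K) (hρ0 : 0 ≤ ρ) (hρ1 : ρ < 1)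
    (h : ∀ n, f (n * B) ≤ K * ρ ^ n) : Summable f := by
  have hgeom := (summable_geometric_of_lt_one hρ0 hρ1).mul_left (B * K)
  refine summable_of_sum_range_le (c := ∑' n, B * K * ρ ^ n) h0 fun n => ?_
  have hblock : ∀ N : ℕ, ∑ k ∈ Finset.range (N * B), f k
      ≤ ∑ n ∈ Finset.range N, B * K * ρ ^ n := by
    intro N
    induction N with
    | zero => simp
    | succ N ih =>
      rw [Nat.succ_mul, Finset.sum_range_add, Finset.sum_range_succ]
      refine add_le_add ih ?_
      calc ∑ r ∈ Finset.range B, f (N * B + r) ≤ ∑ r ∈ Finset.range B, K * ρ ^ N :=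
            Finset.sum_le_sum fun r _ => (hf (Nat.le_add_right _ r)).trans (h N)
        _ = B * K * ρ ^ N := by simp [mul_assoc]
  calc ∑ k ∈ Finset.range n, f k ≤ ∑ k ∈ Finset.range (n * B), f k :=
        Finset.sum_le_sum_of_subset_of_nonneg
          (Finset.range_mono (Nat.le_mul_of_pos_right n hB)) fun k _ _ => h0 k
    _ ≤ _ := hblock n
    _ ≤ _ := hgeom.sum_le_tsum _ fun k _ => by positivity

theorem eq_zero_of_tendsto_of_hasDerivWithinAt {f f' : ℝ → ℝ} {l c : ℝ}
    (hf : ∀ t, 0 ≤ t → HasDerivWithinAt f (f' t) (Set.Ici 0) t)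
    (hl : Tendsto f atTop (𝓝 l)) (hc : Tendsto f' atTop (𝓝 c)) : c = 0 := by
  have hmvt : ∀ n : ℕ, ∃ ξ : ℝ, (n : ℝ) < ξ ∧ f' ξ = f (n + 1) - f n := by
    intro n
    have hn : (0 : ℝ) ≤ n := n.cast_nonneg
    obtain ⟨ξ, hξ, h⟩ := exists_hasDerivAt_eq_slope f f' (lt_add_one (n : ℝ))
      (fun t ht => ((hf t (hn.trans ht.1)).continuousWithinAt).mono
        (fun s hs => hn.trans hs.1))
      (fun t ht => (hf t (hn.trans ht.1.le)).hasDerivAt (Ici_mem_nhds (hn.trans_lt ht.1)))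
    exact ⟨ξ, hξ.1, by simpa using h⟩
  choose ξ hξ h using hmvt
  have h1 : Tendsto (fun n => f' (ξ n)) atTop (𝓝 c) :=
    hc.comp (tendsto_atTop_mono (fun n => (hξ n).le) tendsto_natCast_atTop_atTop)
  have h2 : Tendsto (fun n : ℕ => f ((n : ℝ) + 1) - f n) atTop (𝓝 (l - l)) :=
    (hl.comp (tendsto_atTop_add_const_right _ _ tendsto_natCast_atTop_atTop)).sub
      (hl.comp tendsto_natCast_atTop_atTop)
  simp only [h] at h1
  simpa using tendsto_nhds_unique h1 h2

namespace QueueModel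

variable {M : ℕ} (m : QueueModel M)

/-! ### The mass between two thresholds -/

/-- The number of jobs, per server, lying beyond the threshold `x` and not beyond `y`. -/
noncomputable def mass (x y : ℝ) (u : Fin M → ℕ → ℝ) : ℝ :=
  ∑ j, m.γ j * ∑ k ∈ Finset.Ico (m.level x j) (m.level y j), u j (k + 1)

variable {m} {u w g : Fin M → ℕ → ℝ} {U : ℝ → Fin M → ℕ → ℝ} {x y : ℝ}

theorem mass_sub : m.mass x y (u - w) = m.mass x y u - m.mass x y w := by
  simp only [mass, ← Finset.sum_sub_distrib, ← mul_sub, Pi.sub_apply]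

theorem mass_mono (h : u ≤ w) : m.mass x y u ≤ m.mass x y w :=
  Finset.sum_le_sum fun j _ => mul_le_mul_of_nonneg_left
    (Finset.sum_le_sum fun k _ => h j (k + 1)) (m.γ_pos j).le

theorem mass_nonneg (h : 0 ≤ u) : 0 ≤ m.mass x y u :=
  Finset.sum_nonneg fun j _ => mul_nonneg (m.γ_pos j).le (Finset.sum_nonneg fun k _ => h j (k + 1))

theorem mul_sum_le_mass (h : 0 ≤ u) (j : Fin M) :
    m.γ j * ∑ k ∈ Finset.Ico (m.level x j) (m.level y j), u j (k + 1) ≤ m.mass x y u :=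
  Finset.single_le_sum (f := fun j => m.γ j *
      ∑ k ∈ Finset.Ico (m.level x j) (m.level y j), u j (k + 1))
    (fun j _ => mul_nonneg (m.γ_pos j).le (Finset.sum_nonneg fun k _ => h j (k + 1)))
    (Finset.mem_univ j)

theorem mass_le_tsum (h : 0 ≤ u) (hs : ∀ j, Summable (u j)) :
    m.mass x y u ≤ ∑ j, m.γ j * ∑' k, u j k := by
  refine Finset.sum_le_sum fun j _ => mul_le_mul_of_nonneg_left ?_ (m.γ_pos j).le
  rw [Finset.sum_Ico_add' (fun k => u j k)]
  exact (hs j).sum_le_tsum _ fun k _ => h j k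

theorem hasDerivWithinAt_mass (hU : IsMeanFieldSolution m.drift g U) (hx : 0 ≤ x) (hxy : x ≤ y)
    {t : ℝ} (ht : 0 ≤ t) :
    HasDerivWithinAt (fun s => m.mass x y (U s))
      (m.lam * (m.overflow x (U t) - m.overflow y (U t))
        - m.mu * (m.outflow x (U t) - m.outflow y (U t))) (Set.Ici 0) t := by
  rw [← sum_drift_eq (U t) hx hxy]
  exact HasDerivWithinAt.fun_sum fun j _ => (HasDerivWithinAt.fun_sum fun k _ =>
    hU.deriv t ht j (k + 1)).const_mul _

theorem mass_le_mass_add (hU : IsMeanFieldSolution m.drift g U) (hy : 0 ≤ y) {t : ℝ}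
    (ht : 0 ≤ t) : m.mass 0 y (U t) ≤ m.mass 0 y g + m.lam * t := by
  refine le_of_hasDerivWithinAt_le (g := fun s => m.mass 0 y g + m.lam * s)
    (fun s hs => hasDerivWithinAt_mass hU le_rfl hy hs)
    (fun s _ => (((hasDerivAt_id s).const_mul m.lam).const_add _).hasDerivWithinAt)
    (by simp [hU.init]) (fun s hs => ?_) ht
  have h1 := mul_le_of_le_one_right m.lam_pos.le (overflow_le_one (m := m) (hU.mem s hs) 0)
  have h2 := mul_nonneg m.lam_pos.le (overflow_nonneg (m := m) (hU.mem s hs) y)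
  have h3 := mul_nonneg m.mu_pos.le (sub_nonneg.2 (outflow_antitone (m := m) (hU.mem s hs) hy))
  simp only at h3
  linarith

/-- In bounded time the coordinates of a solution approach `η` uniformly as the level grows, if
the initial state has finite mass above `η`. -/
theorem tail_bound (hU : IsMeanFieldSolution m.drift g U) {η B : ℝ}
    (hη : ∀ t, 0 ≤ t → ∀ j k, η ≤ U t j k)
    (hB : ∀ y, 0 ≤ y → m.mass 0 y (g - fun _ _ => η) ≤ B) (j : Fin M) (N : ℕ) {t : ℝ}
    (ht : 0 ≤ t) : m.γ j * (N * (U t j N - η)) ≤ m.lam * t + B := by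
  have hy : (0 : ℝ) ≤ N / m.a j := div_nonneg N.cast_nonneg (m.a_pos j).le
  have h1 := mass_le_mass_add hU hy ht
  have h2 := hB _ hy
  have h3 : m.mass 0 (N / m.a j) (U t - fun _ _ => η) ≤ m.lam * t + B := by
    rw [mass_sub] at h2 ⊢; linarith
  refine le_trans ?_ ((mul_sum_le_mass (fun i k => sub_nonneg.2 (hη t ht i k)) j).trans h3)
  refine mul_le_mul_of_nonneg_left ?_ (m.γ_pos j).le
  rw [level_zero, level_div, ← Finset.range_eq_Ico]
  calc (N : ℝ) * (U t j N - η) = ∑ k ∈ Finset.range N, (U t j N - η) := by simp [mul_sub]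
    _ ≤ _ := Finset.sum_le_sum fun k hk => sub_le_sub_right
        (antitone_of_mem_tailSpaceBar (hU.mem t ht) j (Finset.mem_range.1 hk)) _

theorem tendsto_level (j : Fin M) : Tendsto (fun y => m.level y j) atTop atTop :=
  tendsto_nat_ceil_atTop.comp (tendsto_id.const_mul_atTop (m.a_pos j))

theorem tendsto_outflow {η : ℝ} (h : ∀ j, Tendsto (u j) atTop (𝓝 η)) :
    Tendsto (fun y => m.outflow y u) atTop (𝓝 (∑ j, m.γ j * m.C j * η)) :=
  tendsto_finsetSum _ fun j _ => ((h j).comp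
    ((tendsto_add_atTop_nat 1).comp (tendsto_level j))).const_mul _

/-! ### Equilibria as limits of increasing solutions -/

theorem drift_flatState_nonneg {η : ℝ} (h0 : 0 ≤ η) (h1 : η ≤ 1) :
    0 ≤ m.drift (flatState M η) := by
  intro j k
  cases k with
  | zero => exact le_rfl
  | succ k =>
    have := arrival_nonneg (m := m) (flatState_mem_tailSpaceBar h0 h1) j k
    simp only [drift, Pi.zero_apply]
    simpa [flatState] using this

theorem drift_eq_zero_of_tendsto (hU : IsMeanFieldSolution m.drift g U)
    (hlim : Tendsto U atTop (𝓝 w)) (j : Fin M) (k : ℕ) : m.drift w j k = 0 :=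
  eq_zero_of_tendsto_of_hasDerivWithinAt (fun t ht => hU.deriv t ht j k)
    (tendsto_pi_nhds.1 (tendsto_pi_nhds.1 hlim j) k)
    (((m.continuous_drift j k).tendsto w).comp hlim)

theorem exists_tendsto_of_monotoneOn (hU : IsMeanFieldSolution m.drift g U)
    (hmono : MonotoneOn U (Set.Ici 0)) :
    ∃ w ∈ tailSpaceBar M, Tendsto U atTop (𝓝 w) ∧ ∀ t, 0 ≤ t → U t ≤ w := by
  have hmono' : ∀ j k, Monotone fun t => U (max t 0) j k := fun j k s t hst =>
    hmono (le_max_right s 0) (le_max_right t 0) (max_le_max_right 0 hst) j k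
  have hbdd : ∀ j k, BddAbove (Set.range fun t => U (max t 0) j k) := fun j k => ⟨1, by
    rintro _ ⟨t, rfl⟩
    exact le_one_of_mem_tailSpaceBar (hU.mem _ (le_max_right t 0)) j k⟩
  have hlim : Tendsto U atTop (𝓝 fun j k => ⨆ t, U (max t 0) j k) := by
    refine tendsto_pi_nhds.2 fun j => tendsto_pi_nhds.2 fun k => ?_
    refine (tendsto_atTop_ciSup (hmono' j k) (hbdd j k)).congr' ?_
    filter_upwards [eventually_ge_atTop 0] with t ht
    rw [max_eq_left ht]
  refine ⟨_, (isClosed_tailSpaceBar M).mem_of_tendsto hlim ?_, hlim, fun t ht j k => ?_⟩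
  · filter_upwards [eventually_ge_atTop 0] with t ht using hU.mem t ht
  · simpa [max_eq_left ht] using le_ciSup (hbdd j k) t

theorem drift_nonneg_of_monotoneOn (hU : IsMeanFieldSolution m.drift g U)
    (hmono : MonotoneOn U (Set.Ici 0)) {t : ℝ} (ht : 0 ≤ t) : 0 ≤ m.drift (U t) := by
  intro j k
  have h1 : MonotoneOn (fun s => U s j k) (Set.Ici 0) := fun a ha b hb hab =>
    hmono ha hb hab j k
  have h2 := h1.derivWithin_nonneg (x := t)
  rwa [(hU.deriv t ht j k).derivWithin (uniqueDiffOn_Ici 0 t ht)] at h2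

theorem tendsto_flat_solution {η : ℝ} (h0 : 0 ≤ η) (h1 : η ≤ 1)
    (hU : IsMeanFieldSolution m.drift (flatState M η) U) {t : ℝ} (ht : 0 ≤ t) (j : Fin M) :
    Tendsto (U t j) atTop (𝓝 η) := by
  have hle : ∀ t, 0 ≤ t → ∀ j k, η ≤ U t j k := fun t ht j k => by
    refine le_trans ?_ (subsolution_le_solution hU (flatState_mem_tailSpaceBar h0 h1)
      (drift_flatState_nonneg h0 h1) le_rfl ht j k)
    unfold flatState; split_ifs
    · exact h1
    · exact le_rfl
  have hB : ∀ y, 0 ≤ y → m.mass 0 y (flatState M η - fun _ _ => η) ≤ 0 := fun y _ => by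
    simp [mass, flatState]
  have hγ := m.γ_pos j
  have hlim : Tendsto (fun N : ℕ => η + m.lam * t / m.γ j / N) atTop (𝓝 η) := by
    simpa using (tendsto_const_div_atTop_nhds_zero_nat (m.lam * t / m.γ j)).const_add η
  refine tendsto_of_tendsto_of_tendsto_of_le_of_le' tendsto_const_nhds hlim
    (Eventually.of_forall fun N => hle t ht j N) ?_
  filter_upwards [eventually_gt_atTop 0] with N hN
  have hN' : (0 : ℝ) < N := Nat.cast_pos.2 hN
  have h3 := tail_bound hU hle hB j N ht
  have h4 : U t j N - η ≤ m.lam * t / m.γ j / N := by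
    rw [le_div_iff₀ hN', le_div_iff₀ hγ]; linarith
  linarith

/-- The solution from a flat state increases to an equilibrium. The estimate in the conclusion says
that the mass above `η` beyond any threshold never decreased. -/
theorem exists_flat_equilibrium {η : ℝ} (h0 : 0 ≤ η) (h1 : η ≤ 1)
    (hU : IsMeanFieldSolution m.drift (flatState M η) U) :
    ∃ w ∈ tailSpaceBar M, Tendsto U atTop (𝓝 w) ∧ (∀ j k, m.drift w j k = 0) ∧
      (∀ j k, η ≤ w j k) ∧ ∀ x, 0 ≤ x →
        m.mu * (m.outflow x w - ∑ j, m.γ j * m.C j * η) ≤ m.lam * m.overflow x w := by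
  have hmono := solution_monotone hU (flatState_mem_tailSpaceBar h0 h1)
    (drift_flatState_nonneg h0 h1)
  obtain ⟨w, hw, hlim, hle⟩ := exists_tendsto_of_monotoneOn hU hmono
  refine ⟨w, hw, hlim, drift_eq_zero_of_tendsto hU hlim, fun j k => ?_, fun x hx => ?_⟩
  · have h2 := hle 0 le_rfl
    rw [hU.init] at h2
    refine le_trans ?_ (h2 j k)
    unfold flatState; split_ifs
    · exact h1
    · exact le_rfl
  · have key : ∀ t, 0 ≤ t → m.mu * (m.outflow x (U t) - ∑ j, m.γ j * m.C j * η)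
        ≤ m.lam * m.overflow x (U t) := by
      intro t ht
      have hout := tendsto_outflow (m := m) (tendsto_flat_solution h0 h1 hU ht)
      refine le_of_tendsto ((hout.const_sub (m.outflow x (U t))).const_mul m.mu) ?_
      filter_upwards [eventually_ge_atTop x] with y hy
      have h2 := sum_drift_eq (m := m) (U t) hx hy
      have h3 : 0 ≤ ∑ j, m.γ j * ∑ k ∈ Finset.Ico (m.level x j) (m.level y j),
          m.drift (U t) j (k + 1) := Finset.sum_nonneg fun j _ => mul_nonneg (m.γ_pos j).le
        (Finset.sum_nonneg fun k _ => drift_nonneg_of_monotoneOn hU hmono ht j (k + 1))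
      have h4 := mul_nonneg m.lam_pos.le (overflow_nonneg (m := m) (hU.mem t ht) y)
      linarith
    have c1 : Continuous fun u => m.outflow x u := by unfold outflow; fun_prop
    have c2 : Continuous fun u => m.overflow x u := by unfold overflow; fun_prop
    refine le_of_tendsto_of_tendsto
      ((((c1.tendsto w).comp hlim).sub_const _).const_mul m.mu)
      (((c2.tendsto w).comp hlim).const_mul m.lam) ?_
    filter_upwards [eventually_ge_atTop 0] with t ht using key t ht

/-- The stability condition turns the flow inequality at the thresholds into geometric decay: over
a step in which every level rises by at least one, the total capacity in use shrinks by the factor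
`lam / (mu * ∑ j, γ j * C j)`. -/
theorem summable_of_outflow_le (hw : w ∈ tailSpaceBar M)
    (h : ∀ x, 0 ≤ x → m.mu * m.outflow x w ≤ m.lam * m.overflow x w) (j : Fin M) :
    Summable (w j) := by
  set S := ∑ j, m.γ j * m.C j with hS
  have hγC : ∀ j, 0 < m.γ j * m.C j := fun j => mul_pos (m.γ_pos j) (m.C_pos j)
  have hSpos : 0 < S := Finset.sum_pos (fun j _ => hγC j) ⟨j, Finset.mem_univ j⟩
  have hμS : 0 < m.mu * S := mul_pos m.mu_pos hSpos
  set ρ := m.lam / (m.mu * S) with hρ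
  have hρ0 : 0 ≤ ρ := (div_pos m.lam_pos hμS).le
  have hρ1 : ρ < 1 := (div_lt_one hμS).2 m.stable
  set step := ∑ i, 1 / m.a i with hstep
  have hstep0 : 0 ≤ step := Finset.sum_nonneg fun i _ => (one_div_pos.2 (m.a_pos i)).le
  have hstep1 : ∀ i, 1 ≤ m.a i * step := fun i => by
    rw [← div_le_iff₀' (m.a_pos i)]
    exact Finset.single_le_sum (f := fun i => 1 / m.a i)
      (fun i _ => (one_div_pos.2 (m.a_pos i)).le) (Finset.mem_univ i)
  set T : ℝ → ℝ := fun x => ∑ i, m.γ i * m.C i * w i (m.level x i) with hT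
  have hTstep : ∀ x, 0 ≤ x → T (x + step) ≤ ρ * T x := by
    intro x hx
    have e1 : T (x + step) ≤ m.outflow x w := by
      refine Finset.sum_le_sum fun i _ => mul_le_mul_of_nonneg_left
        (antitone_of_mem_tailSpaceBar hw i ?_) (hγC i).le
      rw [level, level, ← Nat.ceil_add_one (mul_nonneg (m.a_pos i).le hx), mul_add]
      exact Nat.ceil_mono (by linarith [hstep1 i])
    have e2 : S * m.overflow x w ≤ T x := by
      rw [hS, Finset.sum_mul]
      exact Finset.sum_le_sum fun i _ => mul_le_mul_of_nonneg_left (overflow_le hw x i) (hγC i).le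
    have e3 := mul_le_mul_of_nonneg_left e1 hμS.le
    have e4 := mul_le_mul_of_nonneg_left e2 m.lam_pos.le
    have e5 := mul_le_mul_of_nonneg_left (h x hx) hSpos.le
    rw [hρ, div_mul_eq_mul_div, le_div_iff₀ hμS]
    linarith
  have hTpow : ∀ n : ℕ, T (n * step) ≤ S * ρ ^ n := by
    intro n
    induction n with
    | zero => simp [hT, hS, (hw _).1]
    | succ n ih =>
      have e1 := hTstep (n * step) (by positivity)
      have e2 := mul_le_mul_of_nonneg_left ih hρ0
      have e3 : ((n + 1 : ℕ) : ℝ) * step = n * step + step := by push_cast; ring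
      rw [e3, pow_succ]
      linarith
  refine summable_of_antitone_of_le_geometric (B := ⌈m.a j * step⌉₊) (K := S / (m.γ j * m.C j))
    (antitone_of_mem_tailSpaceBar hw j) (zero_le_of_mem_tailSpaceBar hw j)
    (Nat.one_le_ceil_iff.2 (zero_lt_one.trans_le (hstep1 j))) (div_pos hSpos (hγC j)).le
    hρ0 hρ1 fun n => ?_
  have e1 : m.level (n * step) j ≤ n * ⌈m.a j * step⌉₊ := by
    refine Nat.ceil_le.2 ?_
    push_cast
    rw [mul_left_comm]
    exact mul_le_mul_of_nonneg_left (Nat.le_ceil _) n.cast_nonneg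
  have e2 : m.γ j * m.C j * w j (m.level (n * step) j) ≤ T (n * step) :=
    Finset.single_le_sum (f := fun i => m.γ i * m.C i * w i (m.level (n * step) i))
      (fun i _ => mul_nonneg (hγC i).le (zero_le_of_mem_tailSpaceBar hw _ _)) (Finset.mem_univ j)
  have e3 := e2.trans (hTpow n)
  rw [div_mul_eq_mul_div, le_div_iff₀ (hγC j), mul_comm]
  exact (mul_le_mul_of_nonneg_left (antitone_of_mem_tailSpaceBar hw j e1) (hγC j).le).trans e3

variable (m) in
/-- The system started without jobs increases to an equilibrium of finite mass. -/
theorem exists_equilibrium : ∃ (P : Fin M → ℕ → ℝ) (V : ℝ → Fin M → ℕ → ℝ),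
    IsEquilibrium m.drift P ∧ IsMeanFieldSolution m.drift (flatState M 0) V ∧
      Tendsto V atTop (𝓝 P) := by
  obtain ⟨V, hV⟩ := exists_solution (m := m) (flatState_mem_tailSpaceBar (M := M) le_rfl
    zero_le_one)
  obtain ⟨P, hP, hlim, heq, -, hout⟩ := exists_flat_equilibrium le_rfl zero_le_one hV
  exact ⟨P, V, ⟨⟨hP, summable_of_outflow_le hP fun x hx => by simpa using hout x hx⟩, heq⟩, hV,
    hlim⟩

end QueueModel

/-! ### The metric of the state space -/

section TailDist

variable {M : ℕ} {u w : Fin M → ℕ → ℝ}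

theorem abs_sub_le_one_of_mem_tailSpaceBar (hu : u ∈ tailSpaceBar M) (hw : w ∈ tailSpaceBar M)
    (j : Fin M) (k : ℕ) : |u j k - w j k| ≤ 1 := by
  have := zero_le_of_mem_tailSpaceBar hu j k
  have := zero_le_of_mem_tailSpaceBar hw j k
  have := le_one_of_mem_tailSpaceBar hu j k
  have := le_one_of_mem_tailSpaceBar hw j k
  rw [abs_le]; constructor <;> linarith

theorem abs_sub_le_mul_tailDist (hu : u ∈ tailSpaceBar M) (hw : w ∈ tailSpaceBar M)
    (j : Fin M) (k : ℕ) : |u j k - w j k| ≤ tailDist u w * (k + 1) := by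
  have hbdd : ∀ j, BddAbove (Set.range fun n : ℕ => |u j n - w j n| / ((n : ℝ) + 1)) := fun j =>
    ⟨1, by
      rintro _ ⟨n, rfl⟩
      have := abs_sub_le_one_of_mem_tailSpaceBar hu hw j n
      exact div_le_one_of_le₀ (by linarith [n.cast_nonneg (α := ℝ)]) (by positivity)⟩
  rw [← div_le_iff₀ (by positivity)]
  exact (le_ciSup (hbdd j) k).trans (le_ciSup
    (f := fun j => ⨆ n : ℕ, |u j n - w j n| / ((n : ℝ) + 1)) (Set.finite_range _).bddAbove j)

theorem tailDist_nonneg (u w : Fin M → ℕ → ℝ) : 0 ≤ tailDist u w :=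
  Real.iSup_nonneg fun _ => Real.iSup_nonneg fun _ => by positivity

/-- Only finitely many levels matter up to an error `ε`, because of the weights `1 / (n + 1)`. -/
theorem tailDist_le_of_forall_lt (hu : u ∈ tailSpaceBar M) (hw : w ∈ tailSpaceBar M) {ε : ℝ}
    {K : ℕ} (hε : 0 < ε) (hK : 1 / ε ≤ K) (h : ∀ j, ∀ k < K, |u j k - w j k| ≤ ε) :
    tailDist u w ≤ ε := by
  refine Real.iSup_le (fun j => Real.iSup_le (fun k => ?_) hε.le) hε.le
  rw [div_le_iff₀ (by positivity)]
  rcases lt_or_ge k K with hk | hk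
  · nlinarith [h j k hk, k.cast_nonneg (α := ℝ)]
  · refine (abs_sub_le_one_of_mem_tailSpaceBar hu hw j k).trans ?_
    have h1 : 1 / ε ≤ (k : ℝ) + 1 := by
      have : (K : ℝ) ≤ k := Nat.cast_le.2 hk
      linarith
    rwa [div_le_iff₀' hε] at h1

theorem tendsto_tailDist {U : ℝ → Fin M → ℕ → ℝ} (hU : ∀ t, 0 ≤ t → U t ∈ tailSpaceBar M)
    (hw : w ∈ tailSpaceBar M) (h : Tendsto U atTop (𝓝 w)) :
    Tendsto (fun t => tailDist (U t) w) atTop (𝓝 0) := by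
  refine tendsto_order.2 ⟨fun a ha => Eventually.of_forall fun t =>
    ha.trans_le (tailDist_nonneg _ _), fun ε hε => ?_⟩
  obtain ⟨K, hK⟩ := exists_nat_ge (1 / (ε / 2))
  have h1 : ∀ᶠ t in atTop, ∀ j, ∀ k ∈ Finset.range K, |U t j k - w j k| < ε / 2 :=
    eventually_all.2 fun j => (Finset.eventually_all _).2 fun k _ => by
      have := (tendsto_pi_nhds.1 (tendsto_pi_nhds.1 h j) k).eventually
        (Metric.ball_mem_nhds _ (half_pos hε))
      simpa [Real.dist_eq] using this
  filter_upwards [h1, eventually_ge_atTop 0] with t ht ht0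
  exact (tailDist_le_of_forall_lt (hU t ht0) hw (half_pos hε) hK
    fun j k hk => (ht j k (Finset.mem_range.2 hk)).le).trans_lt (half_lt_self hε)

end TailDist

/-- Barbalat's lemma for a nonnegative Lipschitz function. -/
theorem tendsto_zero_of_integral_le {f : ℝ → ℝ} {K B : ℝ} (hf0 : ∀ t, 0 ≤ t → 0 ≤ f t)
    (hK : 0 ≤ K) (hlip : ∀ s t, 0 ≤ s → 0 ≤ t → |f t - f s| ≤ K * |t - s|)
    (hB : ∀ t, 0 ≤ t → ∫ s in (0 : ℝ)..t, f s ≤ B) : Tendsto f atTop (𝓝 0) := by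
  have hcont : ContinuousOn f (Set.Ici 0) := by
    refine LipschitzOnWith.continuousOn (K := K.toNNReal) (LipschitzOnWith.of_dist_le_mul ?_)
    intro s hs t ht
    simpa [Real.dist_eq, Real.coe_toNNReal K hK] using hlip t s ht hs
  have hint : ∀ a b, 0 ≤ a → 0 ≤ b → IntervalIntegrable f MeasureTheory.volume a b :=
    fun a b ha hb => (hcont.mono fun x hx => (le_min ha hb).trans hx.1).intervalIntegrable
  set I : ℝ → ℝ := fun t => ∫ s in (0 : ℝ)..(max t 0), f s with hI
  have hdiff : ∀ a b, 0 ≤ a → a ≤ b → I b - I a = ∫ s in a..b, f s := fun a b ha hab => by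
    simp only [hI, max_eq_left ha, max_eq_left (ha.trans hab)]
    exact intervalIntegral.integral_interval_sub_left (hint _ _ le_rfl (ha.trans hab))
      (hint _ _ le_rfl ha)
  have hmono : Monotone I := by
    have h1 : ∀ a b, 0 ≤ a → a ≤ b → I a ≤ I b := fun a b ha hab => by
      rw [← sub_nonneg, hdiff a b ha hab]
      exact intervalIntegral.integral_nonneg hab fun s hs => hf0 s (ha.trans hs.1)
    intro a b hab
    have := h1 _ _ (le_max_right a 0) (max_le_max_right 0 hab)
    simpa [hI] using this
  have hlim := tendsto_atTop_ciSup hmono ⟨B, by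
    rintro _ ⟨t, rfl⟩; exact hB _ (le_max_right t 0)⟩
  refine tendsto_order.2 ⟨fun a ha => ?_, fun ε hε => ?_⟩
  · filter_upwards [eventually_ge_atTop 0] with t ht using ha.trans_le (hf0 t ht)
  set h : ℝ := ε / (2 * (K + 1)) with hh
  have hpos : 0 < h := by positivity
  have hKh : K * h < ε / 2 := by
    rw [hh, ← mul_div_assoc, div_lt_iff₀ (by positivity)]
    nlinarith
  have hinc : Tendsto (fun t => I (t + h) - I t) atTop (𝓝 0) := by
    simpa using (hlim.comp (tendsto_atTop_add_const_right _ h tendsto_id)).sub hlim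
  have hsmall := (tendsto_order.1 hinc).2 (h * (ε / 2)) (by positivity)
  filter_upwards [hsmall, eventually_ge_atTop 0] with t ht ht0
  -- on `[t, t + h]` the function stays above `f t - K * h`
  have hlow : h * (f t - K * h) ≤ I (t + h) - I t := by
    rw [hdiff t (t + h) ht0 (by linarith)]
    have : ∫ s in t..(t + h), (f t - K * h) ≤ ∫ s in t..(t + h), f s := by
      refine intervalIntegral.integral_mono_on (by linarith) (by simp)
        (hint _ _ ht0 (by linarith)) fun s hs => ?_
      have h1 := (abs_le.1 (hlip t s ht0 (ht0.trans hs.1))).1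
      have h2 : K * |s - t| ≤ K * h := by
        refine mul_le_mul_of_nonneg_left ?_ hK
        rw [abs_of_nonneg (sub_nonneg.2 hs.1)]; linarith [hs.2]
      linarith
    rwa [intervalIntegral.integral_const, smul_eq_mul, add_sub_cancel_left] at this
  have h3 := lt_of_mul_lt_mul_left (hlow.trans_lt ht) hpos.le
  linarith

namespace QueueModel

open MeasureTheory

variable {M : ℕ} {m : QueueModel M} {g P : Fin M → ℕ → ℝ} {U : ℝ → Fin M → ℕ → ℝ}

/-! ### Convergence to the equilibrium -/

theorem continuousOn_solution (hU : IsMeanFieldSolution m.drift g U) :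
    ContinuousOn U (Set.Ici 0) :=
  continuousOn_pi.2 fun j => continuousOn_pi.2 fun k => fun t ht =>
    (hU.deriv t ht j k).continuousWithinAt

theorem equilibrium_le_solution (hP : IsEquilibrium m.drift P)
    (hU : IsMeanFieldSolution m.drift g U) (h : P ≤ g) {t : ℝ} (ht : 0 ≤ t) : P ≤ U t :=
  solution_le_solution (isMeanFieldSolution_const hP.1.1 hP.2) hU h ht

theorem equilibrium_balance (hP : IsEquilibrium m.drift P) {x y : ℝ} (hx : 0 ≤ x) (hxy : x ≤ y) :
    m.lam * (m.overflow x P - m.overflow y P) = m.mu * (m.outflow x P - m.outflow y P) := by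
  have h := sum_drift_eq (m := m) P hx hxy
  simp only [hP.2, Finset.sum_const_zero, mul_zero] at h
  linarith

/-- The excess departures beyond a threshold are bounded by the excess arrivals beyond it and the
initial mass. -/
theorem integral_outflow_sub_le (hP : IsEquilibrium m.drift P) (hg : g ∈ tailSpace M)
    (hU : IsMeanFieldSolution m.drift g U) (hPg : P ≤ g) {x t : ℝ} (hx : 0 ≤ x) (ht : 0 ≤ t) :
    ∫ s in (0 : ℝ)..t, (m.mu * (m.outflow x (U s) - m.outflow x P)
        - m.lam * (m.overflow x (U s) - m.overflow x P))
      ≤ ∑ j, m.γ j * ∑' k, g j k := by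
  set B := ∑ j, m.γ j * ∑' k, g j k with hB
  have hPU : ∀ s, 0 ≤ s → P ≤ U s := fun s hs => equilibrium_le_solution hP hU hPg hs
  have hg0 : (0 : Fin M → ℕ → ℝ) ≤ g := zero_le_of_mem_tailSpaceBar hg.1
  have c1 : Continuous fun u => m.outflow x u := by unfold outflow; fun_prop
  have c2 : Continuous fun u => m.overflow x u := by unfold overflow; fun_prop
  have hUc : ContinuousOn U (Set.Icc 0 t) := (continuousOn_solution hU).mono fun s hs => hs.1
  have hc : ContinuousOn (fun s => m.mu * (m.outflow x (U s) - m.outflow x P)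
      - m.lam * (m.overflow x (U s) - m.overflow x P)) (Set.Icc 0 t) :=
    (((c1.comp_continuousOn hUc).sub continuousOn_const).const_smul m.mu).sub
      (((c2.comp_continuousOn hUc).sub continuousOn_const).const_smul m.lam)
  -- up to time `t` the departures beyond `y` are at most `err y`, which vanishes as `y` grows
  set err : ℝ → ℝ := fun y => ∑ j, m.C j * ((m.lam * t + B) / ((m.level y j + 1 : ℕ) : ℝ)) with herr
  have herr0 : Tendsto err atTop (𝓝 0) := by
    have : Tendsto err atTop (𝓝 (∑ j, m.C j * 0)) := tendsto_finsetSum _ fun j _ =>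
      ((tendsto_const_div_atTop_nhds_zero_nat (m.lam * t + B)).comp
        ((tendsto_add_atTop_nat 1).comp (tendsto_level j))).const_mul _
    simpa using this
  have hout : ∀ y s, 0 ≤ s → s ≤ t → m.outflow y (U s) ≤ err y := by
    intro y s hs hst
    refine Finset.sum_le_sum fun j _ => ?_
    have h1 := tail_bound hU (η := 0) (B := B)
      (fun s hs j k => zero_le_of_mem_tailSpaceBar (hU.mem s hs) j k)
      (fun y _ => by
        have : (g - fun _ _ => (0 : ℝ)) = g := by ext; simp
        rw [this]; exact mass_le_tsum hg0 hg.2) j (m.level y j + 1) hs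
    have h2 := mul_le_mul_of_nonneg_left hst m.lam_pos.le
    have h3 : (0 : ℝ) < ((m.level y j + 1 : ℕ) : ℝ) := Nat.cast_pos.2 (Nat.succ_pos _)
    rw [mul_comm (m.γ j), mul_assoc]
    refine mul_le_mul_of_nonneg_left ?_ (m.C_pos j).le
    rw [le_div_iff₀ h3]
    linarith
  have key : ∀ y, x ≤ y → ∫ s in (0 : ℝ)..t, (m.mu * (m.outflow x (U s) - m.outflow x P)
        - m.lam * (m.overflow x (U s) - m.overflow x P)) ≤ B + m.mu * err y * t := by
    intro y hxy
    have hd : ∀ s, 0 ≤ s → HasDerivWithinAt (fun s => m.mass x y (U s))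
        (m.lam * (m.overflow x (U s) - m.overflow y (U s))
        - m.mu * (m.outflow x (U s) - m.outflow y (U s))) (Set.Ici 0) s := fun s hs =>
      hasDerivWithinAt_mass hU hx hxy hs
    have h1 := intervalIntegral.sub_le_integral_of_hasDeriv_right_of_le (a := 0) (b := t)
      (g := fun s => m.mass x y (U s))
      (φ := fun s => m.mu * err y - (m.mu * (m.outflow x (U s) - m.outflow x P)
        - m.lam * (m.overflow x (U s) - m.overflow x P))) ht
      (fun s hs => ((hd s hs.1).continuousWithinAt).mono fun r hr => hr.1)
      (fun s hs => (hd s hs.1.le).mono fun r (hr : s < r) => hs.1.le.trans hr.le)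
      ((continuousOn_const.sub hc).integrableOn_Icc)
      (fun s hs => by
        have e1 := equilibrium_balance hP hx hxy
        have e2 := mul_le_mul_of_nonneg_left (hout y s hs.1.le hs.2.le) m.mu_pos.le
        have e3 := mul_nonneg m.mu_pos.le (outflow_nonneg (m := m) hP.1.1 y)
        have e4 := mul_le_mul_of_nonneg_left
          (overflow_mono (m := m) hP.1.1 (hPU s hs.1.le) y) m.lam_pos.le
        linarith)
    rw [intervalIntegral.integral_sub (by simp)
      (hc.intervalIntegrable_of_Icc ht), intervalIntegral.integral_const, smul_eq_mul,
      hU.init] at h1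
    have h2 : m.mass x y P ≤ m.mass x y (U t) := mass_mono (hPU t ht)
    have h3 : 0 ≤ m.mass x y P := mass_nonneg (zero_le_of_mem_tailSpaceBar hP.1.1)
    have h4 : m.mass x y g ≤ B := mass_le_tsum hg0 hg.2
    linarith
  have hlim : Tendsto (fun y => B + m.mu * err y * t) atTop (𝓝 B) := by
    simpa using ((herr0.const_mul m.mu).mul_const t).const_add B
  exact ge_of_tendsto hlim ((eventually_ge_atTop x).mono key)

/-- The bound on the excess `U - P` is passed from one threshold to the next: excess arrivals beyond
a threshold are controlled by the excess at lower levels. -/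
theorem integral_sub_le (hP : IsEquilibrium m.drift P) (hg : g ∈ tailSpace M)
    (hU : IsMeanFieldSolution m.drift g U) (hPg : P ≤ g) (j : Fin M) (k : ℕ) :
    ∃ B, ∀ t, 0 ≤ t → ∫ s in (0 : ℝ)..t, (U s j k - P j k) ≤ B := by
  have hPU : ∀ s, 0 ≤ s → P ≤ U s := fun s hs => equilibrium_le_solution hP hU hPg hs
  have hint : ∀ t, 0 ≤ t → ∀ j k, IntervalIntegrable (fun s => U s j k - P j k) volume 0 t :=
    fun t ht j k => ContinuousOn.intervalIntegrable_of_Icc ht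
      (fun s hs => ((hU.deriv s hs.1 j k).continuousWithinAt.mono fun r hr => hr.1).sub
        continuousWithinAt_const)
  -- over this step every level rises by at most one
  set step : ℝ := 1 / ∑ i, m.a i with hstep
  have hsum : 0 < ∑ i, m.a i := Finset.sum_pos (fun i _ => m.a_pos i) ⟨j, Finset.mem_univ j⟩
  have hstep0 : 0 < step := one_div_pos.2 hsum
  have hstep1 : ∀ i, m.a i * step ≤ 1 := fun i => by
    rw [hstep, mul_one_div]
    exact div_le_one_of_le₀ (Finset.single_le_sum (fun i _ => (m.a_pos i).le) (Finset.mem_univ i))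
      hsum.le
  have key : ∀ n : ℕ, ∀ j, ∀ k ≤ m.level (n * step) j,
      ∃ B, ∀ t, 0 ≤ t → ∫ s in (0 : ℝ)..t, (U s j k - P j k) ≤ B := by
    intro n
    induction n with
    | zero =>
      intro j k hk
      have hk0 : k = 0 := by simpa using hk
      refine ⟨0, fun t ht => le_of_eq ?_⟩
      rw [intervalIntegral.integral_congr (g := fun _ => (0 : ℝ)) fun s hs => ?_]
      · simp
      · rw [Set.uIcc_of_le ht] at hs
        simp [hk0, (hU.mem s hs.1 j).1, (hP.1.1 j).1]
    | succ n ih =>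
      intro j k hk
      set x : ℝ := n * step with hx
      have hx0 : 0 ≤ x := by positivity
      have hlev : m.level ((n + 1 : ℕ) * step) j ≤ m.level x j + 1 := by
        rw [level, level, ← Nat.ceil_add_one (mul_nonneg (m.a_pos j).le hx0)]
        refine Nat.ceil_mono ?_
        push_cast
        rw [add_mul, one_mul, mul_add]
        linarith [hstep1 j]
      rcases Nat.lt_or_ge (m.level x j) k with hk' | hk'
      swap
      · exact ih j k hk'
      obtain rfl : k = m.level x j + 1 := le_antisymm (hk.trans hlev) hk'
      choose B hB using fun i => ih i (m.level x i) le_rfl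
      have hc : 0 < m.mu * (m.γ j * m.C j) :=
        mul_pos m.mu_pos (mul_pos (m.γ_pos j) (m.C_pos j))
      refine ⟨(∑ j, m.γ j * ∑' k, g j k + m.lam * ∑ i, m.d i * B i) / (m.mu * (m.γ j * m.C j)),
        fun t ht => ?_⟩
      rw [le_div_iff₀' hc]
      have h1 := integral_outflow_sub_le hP hg hU hPg hx0 ht
      have hsumint : IntervalIntegrable
          (fun s => ∑ i, (m.d i : ℝ) * (U s i (m.level x i) - P i (m.level x i))) volume 0 t := by
        have := IntervalIntegrable.sum (μ := volume) (a := 0) (b := t) Finset.univ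
          (f := fun i s => (m.d i : ℝ) * (U s i (m.level x i) - P i (m.level x i)))
          fun i _ => (hint t ht i _).const_mul _
        simpa [Finset.sum_fn] using this
      have c1 : Continuous fun u => m.outflow x u := by unfold outflow; fun_prop
      have c2 : Continuous fun u => m.overflow x u := by unfold overflow; fun_prop
      have hUc : ContinuousOn U (Set.Icc 0 t) := (continuousOn_solution hU).mono fun s hs => hs.1
      have hcont : ContinuousOn (fun s => m.mu * (m.outflow x (U s) - m.outflow x P)
          - m.lam * (m.overflow x (U s) - m.overflow x P)) (Set.Icc 0 t) :=
        (((c1.comp_continuousOn hUc).sub continuousOn_const).const_smul m.mu).sub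
          (((c2.comp_continuousOn hUc).sub continuousOn_const).const_smul m.lam)
      have h2 : ∫ s in (0 : ℝ)..t, (m.mu * (m.γ j * m.C j)
            * (U s j (m.level x j + 1) - P j (m.level x j + 1))
          - m.lam * ∑ i, (m.d i : ℝ) * (U s i (m.level x i) - P i (m.level x i)))
          ≤ ∫ s in (0 : ℝ)..t, (m.mu * (m.outflow x (U s) - m.outflow x P)
          - m.lam * (m.overflow x (U s) - m.overflow x P)) := by
        refine intervalIntegral.integral_mono_on ht
          (((hint t ht j _).const_mul _).sub (hsumint.const_mul _))
          (hcont.intervalIntegrable_of_Icc ht) fun s hs => ?_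
        have e1 : m.overflow x (U s) - m.overflow x P
            ≤ ∑ i, (m.d i : ℝ) * (U s i (m.level x i) - P i (m.level x i)) :=
          prod_pow_sub_prod_pow_le Finset.univ m.d
            (fun _ => zero_le_of_mem_tailSpaceBar hP.1.1 _ _) (fun i => hPU s hs.1 i _)
            (fun _ => le_one_of_mem_tailSpaceBar (hU.mem s hs.1) _ _)
        have e2 : m.γ j * m.C j * (U s j (m.level x j + 1) - P j (m.level x j + 1))
            ≤ m.outflow x (U s) - m.outflow x P := by
          rw [outflow, outflow, ← Finset.sum_sub_distrib]
          simp only [← mul_sub]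
          exact Finset.single_le_sum
            (f := fun j => m.γ j * m.C j * (U s j (m.level x j + 1) - P j (m.level x j + 1)))
            (fun i _ => mul_nonneg (mul_nonneg (m.γ_pos i).le (m.C_pos i).le)
              (sub_nonneg.2 (hPU s hs.1 i _))) (Finset.mem_univ j)
        have e3 := mul_le_mul_of_nonneg_left e1 m.lam_pos.le
        have e4 := mul_le_mul_of_nonneg_left e2 m.mu_pos.le
        linarith
      rw [intervalIntegral.integral_sub ((hint t ht j _).const_mul _) (hsumint.const_mul _),
        intervalIntegral.integral_const_mul, intervalIntegral.integral_const_mul,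
        intervalIntegral.integral_finsetSum fun i _ => (hint t ht i _).const_mul _] at h2
      simp only [intervalIntegral.integral_const_mul] at h2
      have h3 : ∑ i, (m.d i : ℝ) * ∫ s in (0 : ℝ)..t, (U s i (m.level x i) - P i (m.level x i))
          ≤ ∑ i, m.d i * B i :=
        Finset.sum_le_sum fun i _ => mul_le_mul_of_nonneg_left (hB i t ht) (Nat.cast_nonneg _)
      have h4 := mul_le_mul_of_nonneg_left h3 m.lam_pos.le
      linarith
  obtain ⟨n, hn⟩ := (((tendsto_level (m := m) j).comp
    (tendsto_natCast_atTop_atTop.atTop_mul_const hstep0)).eventually_ge_atTop k).exists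
  exact key n j k hn

theorem tendsto_of_equilibrium_le (hP : IsEquilibrium m.drift P) (hg : g ∈ tailSpace M)
    (hU : IsMeanFieldSolution m.drift g U) (hPg : P ≤ g) : Tendsto U atTop (𝓝 P) := by
  refine tendsto_pi_nhds.2 fun j => tendsto_pi_nhds.2 fun k => ?_
  obtain ⟨B, hB⟩ := integral_sub_le hP hg hU hPg j k
  have h := tendsto_zero_of_integral_le (f := fun s => U s j k - P j k)
    (fun t ht => sub_nonneg.2 (equilibrium_le_solution hP hU hPg ht j k)) m.rate_nonneg
    (fun s t hs ht => by
      have := (convex_Ici (0 : ℝ)).norm_image_sub_le_of_norm_hasDerivWithin_le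
        (fun r hr => hU.deriv r hr j k) (fun r hr => abs_drift_le (hU.mem r hr) j k) hs ht
      simpa using this) hB
  simpa using h.add_const (P j k)

theorem sup_mem_tailSpace {u w : Fin M → ℕ → ℝ} (hu : u ∈ tailSpace M) (hw : w ∈ tailSpace M) :
    u ⊔ w ∈ tailSpace M := by
  have h := sup_mem_tailSpaceBar hu.1 hw.1
  refine ⟨h, fun j => Summable.of_nonneg_of_le (zero_le_of_mem_tailSpaceBar h j) (fun k => ?_)
    ((hu.2 j).add (hw.2 j))⟩
  have h1 := zero_le_of_mem_tailSpaceBar hu.1 j k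
  have h2 := zero_le_of_mem_tailSpaceBar hw.1 j k
  exact sup_le (by linarith) (by linarith)

/-- A solution is squeezed between the solution that starts without jobs and the one that starts
from the supremum of its initial state and the equilibrium. -/
theorem allSolutionsConverge {V : ℝ → Fin M → ℕ → ℝ} (hP : IsEquilibrium m.drift P)
    (hV : IsMeanFieldSolution m.drift (flatState M 0) V) (hVP : Tendsto V atTop (𝓝 P)) :
    AllSolutionsConverge m.drift P := by
  intro g hg
  obtain ⟨U, hU⟩ := exists_solution (m := m) hg.1
  have hg' := sup_mem_tailSpace hg hP.1
  obtain ⟨W, hW⟩ := exists_solution (m := m) hg'.1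
  refine ⟨U, hU, fun w hw => solution_unique hU hw, tendsto_tailDist hU.mem hP.1.1 ?_⟩
  have hWP := tendsto_of_equilibrium_le hP hg' hW le_sup_right
  refine tendsto_pi_nhds.2 fun j => tendsto_pi_nhds.2 fun k => ?_
  refine tendsto_of_tendsto_of_tendsto_of_le_of_le'
    (tendsto_pi_nhds.1 (tendsto_pi_nhds.1 hVP j) k)
    (tendsto_pi_nhds.1 (tendsto_pi_nhds.1 hWP j) k) ?_ ?_
  · filter_upwards [eventually_ge_atTop 0] with t ht
    exact solution_le_solution hV hU
      (flatState_le hg.1 (zero_le_of_mem_tailSpaceBar hg.1)) ht j k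
  · filter_upwards [eventually_ge_atTop 0] with t ht
    exact solution_le_solution hU hW le_sup_left ht j k

theorem equilibrium_unique {Q : Fin M → ℕ → ℝ} (hP : IsEquilibrium m.drift P)
    (hconv : AllSolutionsConverge m.drift P) (hQ : IsEquilibrium m.drift Q) : Q = P := by
  obtain ⟨u, -, huniq, hlim⟩ := hconv Q hQ.1
  have h1 : tailDist Q P = 0 := by
    refine tendsto_nhds_unique (tendsto_const_nhds.congr' ?_) hlim
    filter_upwards [eventually_ge_atTop 0] with t ht
    rw [← huniq _ (isMeanFieldSolution_const hQ.1.1 hQ.2) ht]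
  ext j k
  have h2 := abs_sub_le_mul_tailDist hQ.1.1 hP.1.1 j k
  rw [h1, zero_mul] at h2
  exact sub_eq_zero.1 (abs_nonpos_iff.1 h2)

end QueueModel

namespace QueueModel

variable {M : ℕ} {m : QueueModel M} {g P : Fin M → ℕ → ℝ} {U : ℝ → Fin M → ℕ → ℝ}

/-! ### Stability from above -/

/-- There are equilibria of infinite mass above `P` and arbitrarily close to it on finitely many
levels: those reached from the flat states, as `η` tends to `0`. Their infimum has finite mass and
is therefore `P`. -/
theorem exists_equilibrium_above (huniq : ∀ Q, IsEquilibrium m.drift Q → Q = P)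
    {ε : ℝ} (hε : 0 < ε) (K : ℕ) :
    ∃ w ∈ tailSpaceBar M, (∀ j k, m.drift w j k = 0) ∧ P ≤ w ∧
      (∃ η > 0, ∀ j k, η ≤ w j k) ∧ ∀ j, ∀ k < K, w j k ≤ P j k + ε := by
  set η : ℕ → ℝ := fun n => 1 / ((n : ℝ) + 1) with hη
  have hη0 : ∀ n, 0 < η n := fun n => Nat.one_div_pos_of_nat
  have hη1 : ∀ n, η n ≤ 1 := fun n => by
    simpa [hη] using Nat.one_div_le_one_div (α := ℝ) (Nat.zero_le n)
  have hanti : Antitone η := fun a b h => Nat.one_div_le_one_div h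
  choose V hV using fun n => exists_solution (m := m)
    (flatState_mem_tailSpaceBar (M := M) (hη0 n).le (hη1 n))
  choose w hw hlim heq hge hout using fun n =>
    exists_flat_equilibrium (hη0 n).le (hη1 n) (hV n)
  have hwanti : Antitone w := fun a b hab =>
    le_of_tendsto_of_tendsto (hlim b) (hlim a) <| by
      filter_upwards [eventually_ge_atTop 0] with t ht
      refine solution_le_solution (hV b) (hV a) (fun j k => ?_) ht
      unfold flatState; split_ifs
      · exact le_rfl
      · exact hanti hab
  have hWlim : Tendsto w atTop (𝓝 fun j k => ⨅ n, w n j k) :=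
    tendsto_pi_nhds.2 fun j => tendsto_pi_nhds.2 fun k =>
      tendsto_atTop_ciInf (fun a b hab => hwanti hab j k) ⟨0, by
        rintro _ ⟨n, rfl⟩; exact zero_le_of_mem_tailSpaceBar (hw n) j k⟩
  have hWmem := (isClosed_tailSpaceBar M).mem_of_tendsto hWlim (Eventually.of_forall hw)
  have c1 : ∀ x, Continuous fun u => m.outflow x u := fun x => by unfold outflow; fun_prop
  have c2 : ∀ x, Continuous fun u => m.overflow x u := fun x => by unfold overflow; fun_prop
  have hηlim : Tendsto η atTop (𝓝 0) := tendsto_one_div_add_atTop_nhds_zero_nat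
  have hWP : (fun j k => ⨅ n, w n j k) = P := by
    refine huniq _ ⟨⟨hWmem, summable_of_outflow_le (m := m) hWmem fun x hx => ?_⟩, fun j k => ?_⟩
    · have h1 : Tendsto (fun n => ∑ j, m.γ j * m.C j * η n) atTop
          (𝓝 (∑ j, m.γ j * m.C j * 0)) := tendsto_finsetSum _ fun j _ => hηlim.const_mul _
      simp only [mul_zero, Finset.sum_const_zero] at h1
      have h2 := ((((c1 x).tendsto _).comp hWlim).sub h1).const_mul m.mu
      rw [sub_zero] at h2
      exact le_of_tendsto_of_tendsto' h2 ((((c2 x).tendsto _).comp hWlim).const_mul m.lam)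
        fun n => hout n x hx
    · refine tendsto_nhds_unique (((m.continuous_drift j k).tendsto _).comp hWlim) ?_
      simp [Function.comp_def, heq]
  have hPle : ∀ n, P ≤ w n := fun n => by
    rw [← hWP]
    exact fun j k => ciInf_le ⟨0, by
      rintro _ ⟨n, rfl⟩; exact zero_le_of_mem_tailSpaceBar (hw n) j k⟩ n
  rw [hWP] at hWlim
  have hev : ∀ᶠ n in atTop, ∀ j, ∀ k ∈ Finset.range K, w n j k < P j k + ε :=
    eventually_all.2 fun j => (Finset.eventually_all _).2 fun k _ =>
      (tendsto_order.1 (tendsto_pi_nhds.1 (tendsto_pi_nhds.1 hWlim j) k)).2 _ (by linarith)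
  obtain ⟨n, hn⟩ := hev.exists
  exact ⟨w n, hw n, heq n, hPle n, ⟨η n, hη0 n, hge n⟩,
    fun j k hk => (hn j k (Finset.mem_range.2 hk)).le⟩

/-- If an equilibrium of infinite mass above `P` agreed with `P` in one coordinate, then, both
drifts vanishing there, it would agree with `P` in all later coordinates of the same type. -/
theorem lt_of_equilibrium_above (hP : IsEquilibrium m.drift P) {w : Fin M → ℕ → ℝ}
    (hw : w ∈ tailSpaceBar M) (heq : ∀ j k, m.drift w j k = 0) (hPw : P ≤ w) {η : ℝ} (hη : 0 < η)
    (hge : ∀ j k, η ≤ w j k) (j : Fin M) {k : ℕ} (hk : 1 ≤ k) : P j k < w j k := by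
  obtain ⟨k, rfl⟩ := Nat.exists_eq_add_of_le' hk
  by_contra hlt
  have hall : ∀ n, w j (k + 1 + n) ≤ P j (k + 1 + n) := by
    intro n
    induction n with
    | zero => exact not_lt.1 hlt
    | succ n ih =>
      have h1 := departure_le_shifted_sub (m := m) hP.1.1 hw hPw j (k + n)
      have h2 : w j (k + n + 1) = P j (k + n + 1) := by
        refine le_antisymm ?_ (hPw _ _)
        rwa [show k + n + 1 = k + 1 + n by ring]
      rw [shifted, shifted, heq, hP.2, h2, sub_self] at h1
      have h3 := nonpos_of_mul_nonpos_right h1 (m.mu_mul_pos j)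
      rw [show k + 1 + (n + 1) = k + n + 2 by ring]
      linarith
  have hlim : Tendsto (fun n => P j (k + 1 + n)) atTop (𝓝 0) :=
    (hP.1.2 j).tendsto_atTop_zero.comp (tendsto_atTop_mono (fun n => Nat.le_add_left n (k + 1))
      tendsto_id)
  exact absurd (ge_of_tendsto' hlim fun n => (hge j _).trans (hall n)) (not_le.2 hη)

theorem exists_forall_solution_le (hP : IsEquilibrium m.drift P)
    (huniq : ∀ Q, IsEquilibrium m.drift Q → Q = P) {ε : ℝ} (hε : 0 < ε) (K : ℕ) :
    ∃ δ > 0, ∀ g ∈ tailSpaceBar M, tailDist g P < δ → ∀ U, IsMeanFieldSolution m.drift g U →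
      ∀ t, 0 ≤ t → ∀ j, ∀ k < K, U t j k ≤ P j k + ε := by
  obtain ⟨w, hw, heq, hPw, ⟨η, hη, hge⟩, hclose⟩ := exists_equilibrium_above huniq hε K
  have hPη : ∀ᶠ n in atTop, ∀ j, P j n < η / 2 := eventually_all.2 fun j =>
    (tendsto_order.1 (hP.1.2 j).tendsto_atTop_zero).2 _ (half_pos hη)
  obtain ⟨N, hN⟩ := hPη.exists
  have hsmall : ∀ c > 0, ∀ᶠ δ : ℝ in 𝓝[>] 0, δ * (N + 1) < c := fun c hc => by
    have h1 : Tendsto (fun δ : ℝ => δ * (N + 1)) (𝓝[>] 0) (𝓝 0) := by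
      have : Tendsto (fun δ : ℝ => δ * (N + 1)) (𝓝 0) (𝓝 (0 * (N + 1))) :=
        tendsto_id.mul_const _
      rw [zero_mul] at this
      exact this.mono_left nhdsWithin_le_nhds
    exact (tendsto_order.1 h1).2 c hc
  have hev : ∀ᶠ δ : ℝ in 𝓝[>] 0, ∀ j, ∀ k ∈ Finset.Icc 1 N, δ * (N + 1) < w j k - P j k :=
    eventually_all.2 fun j => (Finset.eventually_all _).2 fun k hk => hsmall _
      (sub_pos.2 (lt_of_equilibrium_above hP hw heq hPw hη hge j (Finset.mem_Icc.1 hk).1))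
  obtain ⟨δ, ⟨hδ1, hδ2⟩, hδ0⟩ := ((hev.and (hsmall _ (half_pos hη))).and
    self_mem_nhdsWithin).exists
  refine ⟨δ, hδ0, fun g hg hdist U hU t ht j k hk => le_trans ?_ (hclose j k hk)⟩
  refine solution_le_solution hU (isMeanFieldSolution_const hw heq) (fun j k => ?_) ht j k
  have hgP : ∀ k ≤ N, g j k ≤ P j k + δ * (N + 1) := fun k hkN => by
    have h1 := (abs_le.1 (abs_sub_le_mul_tailDist hg hP.1.1 j k)).2
    have h2 : tailDist g P * (k + 1) ≤ δ * (N + 1) := by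
      have : (k : ℝ) ≤ N := Nat.cast_le.2 hkN
      exact mul_le_mul hdist.le (by linarith) (by positivity) (le_of_lt hδ0)
    linarith
  rcases Nat.eq_zero_or_pos k with rfl | hk0
  · rw [(hg j).1, (hw j).1]
  rcases le_or_gt k N with hkN | hkN
  · linarith [hgP k hkN, hδ1 j k (Finset.mem_Icc.2 ⟨hk0, hkN⟩)]
  · -- beyond level `N` the state `g` is below `η`
    linarith [hgP N le_rfl, hN j, hge j k, antitone_of_mem_tailSpaceBar hg j hkN.le]

/-! ### Stability from below -/

/-- Below the equilibrium the missing mass `P - U` does not increase, since the departures are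
slower than at `P`. -/
theorem mul_sub_le_of_le_equilibrium (hP : IsEquilibrium m.drift P)
    (hU : IsMeanFieldSolution m.drift g U) (hgP : g ≤ P) {R : ℝ}
    (hR : ∀ y, m.mass 0 y (P - g) ≤ R) {t : ℝ} (ht : 0 ≤ t) (j : Fin M) (k : ℕ) :
    m.γ j * (P j (k + 1) - U t j (k + 1)) ≤ R := by
  have hUP : ∀ s, 0 ≤ s → U s ≤ P := fun s hs =>
    solution_le_solution hU (isMeanFieldSolution_const hP.1.1 hP.2) hgP hs
  have key : ∀ y, 0 ≤ y → m.mass 0 y (P - U t) ≤ R + m.mu * m.outflow y P * t := by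
    intro y hy
    have h1 := le_of_hasDerivWithinAt_le (f := fun s => m.mass 0 y P - m.mass 0 y (U s))
      (g := fun s => m.mass 0 y P - m.mass 0 y g + m.mu * m.outflow y P * s)
      (fun s hs => (hasDerivWithinAt_mass hU le_rfl hy hs).const_sub _)
      (fun s _ => (((hasDerivAt_id s).const_mul _).const_add _).hasDerivWithinAt)
      (by simp [hU.init]) (fun s hs => by
        have e1 := equilibrium_balance hP le_rfl hy
        have e2 := mul_le_mul_of_nonneg_left
          (overflow_mono (m := m) (hU.mem s hs) (hUP s hs) y) m.lam_pos.le
        have e3 := mul_le_mul_of_nonneg_left (outflow_mono (m := m) (hUP s hs) 0) m.mu_pos.le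
        have e4 := mul_nonneg m.mu_pos.le (outflow_nonneg (m := m) (hU.mem s hs) y)
        rw [overflow_zero hP.1.1] at e1
        rw [overflow_zero (hU.mem s hs)]
        linarith) ht
    have h2 := hR y
    rw [mass_sub] at h2 ⊢
    linarith
  have hlim : Tendsto (fun y => R + m.mu * m.outflow y P * t) atTop (𝓝 R) := by
    have := tendsto_outflow (m := m) fun j => (hP.1.2 j).tendsto_atTop_zero
    simp only [mul_zero, Finset.sum_const_zero] at this
    simpa using ((this.const_mul m.mu).mul_const t).const_add R
  refine ge_of_tendsto hlim ?_
  filter_upwards [eventually_ge_atTop 0, (tendsto_level (m := m) j).eventually_gt_atTop k]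
    with y hy hky
  have hpos : (0 : Fin M → ℕ → ℝ) ≤ P - U t := sub_nonneg.2 (hUP t ht)
  refine le_trans ?_ ((mul_sum_le_mass (m := m) (x := 0) (y := y) hpos j).trans (key y hy))
  refine mul_le_mul_of_nonneg_left ?_ (m.γ_pos j).le
  exact Finset.single_le_sum (f := fun k => (P - U t) j (k + 1)) (fun i _ => hpos j (i + 1))
    (Finset.mem_Ico.2 ⟨by simp, hky⟩)

theorem exists_forall_le_solution (hP : IsEquilibrium m.drift P) {ε : ℝ} (hε : 0 < ε) :
    ∃ δ > 0, ∀ g ∈ tailSpaceBar M, tailDist g P < δ → ∀ U, IsMeanFieldSolution m.drift g U →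
      ∀ t, 0 ≤ t → ∀ j k, P j k - ε ≤ U t j k := by
  have hP0 := zero_le_of_mem_tailSpaceBar hP.1.1
  -- a bound for the mass of `P - P ⊓ g` that vanishes as `δ` tends to `0`, `P` being summable
  set R : ℝ → ℝ := fun δ => ∑ j, m.γ j * ∑' k : ℕ, min (P j k) (δ * (k + 1)) with hR
  have hRlim : Tendsto R (𝓝[>] 0) (𝓝 0) := by
    have h1 : ∀ j, Tendsto (fun δ : ℝ => ∑' k : ℕ, min (P j k) (δ * (k + 1))) (𝓝[>] 0)
        (𝓝 (∑' _ : ℕ, 0)) := by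
      intro j
      refine tendsto_tsum_of_dominated_convergence (hP.1.2 j) (fun k => ?_) ?_
      · have h2 : Tendsto (fun δ : ℝ => min (P j k) (δ * (k + 1))) (𝓝 0)
            (𝓝 (min (P j k) (0 * (k + 1)))) :=
          tendsto_const_nhds.min (tendsto_id.mul_const _)
        rw [zero_mul, min_eq_right (hP0 j k)] at h2
        exact h2.mono_left nhdsWithin_le_nhds
      · filter_upwards [self_mem_nhdsWithin] with δ hδ k
        have hδ' : (0 : ℝ) < δ := hδ
        rw [Real.norm_eq_abs, abs_of_nonneg (le_min (hP0 j k) (by positivity))]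
        exact min_le_left _ _
    have h2 : Tendsto R (𝓝[>] 0) (𝓝 (∑ j, m.γ j * ∑' _ : ℕ, 0)) :=
      tendsto_finsetSum _ fun j _ => (h1 j).const_mul _
    simpa using h2
  have hev : ∀ᶠ δ in 𝓝[>] 0, ∀ j, R δ < m.γ j * ε := eventually_all.2 fun j =>
    (tendsto_order.1 hRlim).2 _ (mul_pos (m.γ_pos j) hε)
  obtain ⟨δ, hδ1, hδ0⟩ := (hev.and self_mem_nhdsWithin).exists
  have hδ0' : (0 : ℝ) < δ := hδ0
  refine ⟨δ, hδ0, fun g hg hdist U hU t ht j k => ?_⟩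
  have hX := inf_mem_tailSpaceBar hP.1.1 hg
  obtain ⟨X, hXsol⟩ := exists_solution (m := m) hX
  refine le_trans ?_ (solution_le_solution hXsol hU inf_le_right ht j k)
  cases k with
  | zero => rw [(hXsol.mem t ht j).1, (hP.1.1 j).1]; linarith
  | succ k =>
    have hmin0 : (0 : Fin M → ℕ → ℝ) ≤ fun j k => min (P j k) (δ * ((k : ℝ) + 1)) :=
      fun j k => le_min (hP0 j k) (by positivity)
    have hmass : ∀ y, m.mass 0 y (P - P ⊓ g) ≤ R δ := fun y => by
      refine le_trans (mass_mono fun j k => ?_) (mass_le_tsum (m := m) hmin0 fun j =>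
        Summable.of_nonneg_of_le (hmin0 j) (fun k => min_le_left _ _) (hP.1.2 j))
      have h1 := (abs_le.1 (abs_sub_le_mul_tailDist hg hP.1.1 j k)).1
      have h2 : tailDist g P * (k + 1) ≤ δ * (k + 1) := by gcongr
      have h3 := zero_le_of_mem_tailSpaceBar hX j k
      simp only [Pi.sub_apply]
      refine le_min (by linarith) ?_
      rw [sub_le_iff_le_add, Pi.inf_apply, Pi.inf_apply, ← sub_le_iff_le_add']
      refine le_inf ?_ ?_
      · have : 0 ≤ δ * ((k : ℝ) + 1) := by positivity
        linarith
      · linarith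
    have h1 := mul_sub_le_of_le_equilibrium hP hXsol inf_le_left hmass ht j k
    have h2 := lt_of_mul_lt_mul_left (h1.trans_lt (hδ1 j)) (m.γ_pos j).le
    linarith

theorem isLyapunovStable (hP : IsEquilibrium m.drift P)
    (huniq : ∀ Q, IsEquilibrium m.drift Q → Q = P) : IsLyapunovStable m.drift P := by
  intro ε hε
  obtain ⟨K, hK⟩ := exists_nat_ge (1 / (ε / 2))
  obtain ⟨δ₁, hδ₁, h1⟩ := exists_forall_solution_le hP huniq (half_pos hε) K
  obtain ⟨δ₂, hδ₂, h2⟩ := exists_forall_le_solution hP (half_pos hε)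
  refine ⟨min δ₁ δ₂, lt_min hδ₁ hδ₂, fun g hg hdist U hU t ht => ?_⟩
  refine (tailDist_le_of_forall_lt (hU.mem t ht) hP.1.1 (half_pos hε) hK fun j k hk => ?_).trans_lt
    (half_lt_self hε)
  have h3 := h1 g hg.1 (hdist.trans_le (min_le_left _ _)) U hU t ht j k hk
  have h4 := h2 g hg.1 (hdist.trans_le (min_le_right _ _)) U hU t ht j k
  rw [abs_le]; constructor <;> linarith

variable (m) in
theorem exists_globallyAsymptoticallyStable_equilibrium : ∃ P : Fin M → ℕ → ℝ,
    IsEquilibrium m.drift P ∧ IsGloballyAsymptoticallyStable m.drift P ∧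
      ∀ Q : Fin M → ℕ → ℝ, IsEquilibrium m.drift Q → Q = P := by
  obtain ⟨P, V, hP, hV, hlim⟩ := m.exists_equilibrium
  have hconv := allSolutionsConverge hP hV hlim
  have huniq : ∀ Q, IsEquilibrium m.drift Q → Q = P := fun Q hQ => equilibrium_unique hP hconv hQ
  exact ⟨P, hP, ⟨isLyapunovStable hP huniq, hconv⟩, huniq⟩

end QueueModel

theorem theorem4 (M : ℕ) (lam mu : ℝ) (γ C : Fin M → ℝ) (d : Fin M → ℕ)
    (hlam : 0 < lam) (hmu : 0 < mu)
    (hγ : ∀ j, 0 < γ j) (hγsum : ∑ j, γ j = 1)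
    (hC : ∀ j, 0 < C j) (hCmono : Monotone C) (hd : ∀ j, 1 ≤ d j)
    (hstable : lam < mu * ∑ j, γ j * C j) :
    (∃ P : Fin M → ℕ → ℝ,
      IsEquilibrium (driftOne lam mu γ C d) P ∧
      IsGloballyAsymptoticallyStable (driftOne lam mu γ C d) P ∧
      ∀ Q : Fin M → ℕ → ℝ, IsEquilibrium (driftOne lam mu γ C d) Q → Q = P) ∧
    (∃ P' : Fin M → ℕ → ℝ,
      IsEquilibrium (driftTwo lam mu γ C d) P' ∧
      IsGloballyAsymptoticallyStable (driftTwo lam mu γ C d) P' ∧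
      ∀ Q : Fin M → ℕ → ℝ, IsEquilibrium (driftTwo lam mu γ C d) Q → Q = P') := by
  let m₁ : QueueModel M := ⟨lam, mu, γ, C, fun _ => 1, d, hlam, hmu, hγ, hγsum, hC,
    fun _ => one_pos, hd, hstable⟩
  let m₂ : QueueModel M := ⟨lam, mu, γ, C, C, d, hlam, hmu, hγ, hγsum, hC, hC, hd, hstable⟩
  have h₁ : driftOne lam mu γ C d = m₁.drift := by
    ext u j k
    cases k with
    | zero => rfl
    | succ k => simp [driftOne, QueueModel.drift, QueueModel.others, m₁, mul_assoc]
  have h₂ : driftTwo lam mu γ C d = m₂.drift := by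
    ext u j k
    cases k with
    | zero => rfl
    | succ k => simp only [driftTwo, QueueModel.drift, QueueModel.others, m₂, mul_assoc]
  rw [h₁, h₂]
  exact ⟨m₁.exists_globallyAsymptoticallyStable_equilibrium,
    m₂.exists_globallyAsymptoticallyStable_equilibrium⟩
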